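/- Let $\mathbf{k}$ be a finite field with $q$ elements, let $\mathbf{v}=\sqrt q$, and let $\Lambda^\imath=\mathbf{k}[x]/(x^2)$, the $\imath$quiver algebra of the quiver $Q$ with one vertex, no arrow and trivial involution. Let $\mathcal A$ be the category of finite-dimensional $\Lambda^\imath$-modules. Let $\widetilde{\mathcal H}$ be the rank-one split $\imath$Hall algebra, that is, the twisted semi-derived Ringel-Hall algebra of $\mathcal A$ over $\mathbb{Q}(\mathbf{v})$, with product $$[M]*[N]=\mathbf{v}^{\langle \mathrm{res}\,M,\,\mathrm{res}\,N\rangle_Q}\sum_{[L]}\frac{|\mathrm{Ext}^1(M,N)_L|}{|\mathrm{Hom}(M,N)|}\,[L],$$ where $\mathrm{res}$ is the restriction to $\mathbf{k}$-modules, $\langle\cdot,\cdot\rangle_Q$ is the Euler form of $Q$, and $\mathrm{Ext}^1(M,N)_L$ is the set of extension classes with middle term $L$. Here one passes to the quotient by the two-sided ideal generated by all $[M]-[N]$ such that $M,N$ have the same class in $K_0(\mathcal A)$ and are isomorphic in the singularity category of $\mathcal A$, and then inverts the elements $a[K]$ with $a\in\mathbb{Q}^\times$ and $K$ of projective dimension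 at most $1$. Let $S$ be the simple $\Lambda^\imath$-module, $mS=S^{\oplus m}$, and let $\mathbb{K}=\mathbf{k}[x]/(x^2)$, regarded as a module over itself. Put $[r]=\frac{\mathbf{v}^r-\mathbf{v}^{-r}}{\mathbf{v}-\mathbf{v}^{-1}}$, $[m]!=\prod_{i=1}^m[i]$ and $[2k]!!=[2k][2k-2]\cdots[2]$ (with $[0]!=[0]!!=1$). For $m\ge 0$ define the $\imath$divided powers of $[S]$ by $$[S]^{(m)}_{\bar 1}=\frac{1}{[m]!}\begin{cases}[S]\prod_{j=1}^{k}\big([S]^2+\mathbf{v}^{-1}(\mathbf{v}^2-1)^2[2j-1]^2[\mathbb{K}]\big), & m=2k+1,\\ \prod_{j=1}^{k}\big([S]^2+\mathbf{v}^{-1}(\mathbf{v}^2-1)^2[2j-1]^2[\mathbb{K}]\big), & m=2k,\end{cases}$$ $$[S]^{(m)}_{\bar 0}=\frac{1}{[m]!}\begin{cases}[S]\prod_{j=1}^{k}\big([S]^2+\mathbf{v}^{-1}(\mathbf{v}^2-1)^2[2j]^2[\mathbb{K}]\big), & m=2k+1,\\ \prod_{j=1}^{k}\big([S]^2+\mathbf{v}^{-1}(\mathbf{v}^2-1)^2[2j-2]^2[\mathbb{K}]\big),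 & m=2k.\end{cases}$$ Then for every integer $n\ge 0$ the following identities hold in $\widetilde{\mathcal H}$: $$[S]^{(n)}_{\bar 0}=\sum_{k=0}^{\lfloor n/2\rfloor}\frac{\mathbf{v}^{k(k-(-1)^n)-\binom{n-2k}{2}}\,(\mathbf{v}-\mathbf{v}^{-1})^k}{[n-2k]!\,[2k]!!}\,[(n-2k)S]*[\mathbb{K}]^k,$$ $$[S]^{(n)}_{\bar 1}=\sum_{k=0}^{\lfloor n/2\rfloor}\frac{\mathbf{v}^{k(k+(-1)^n)-\binom{n-2k}{2}}\,(\mathbf{v}-\mathbf{v}^{-1})^k}{[n-2k]!\,[2k]!!}\,[(n-2k)S]*[\mathbb{K}]^k.$$ -/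

import Mathlib

open CategoryTheory

universe w v u

namespace IHall

/-! ### Extensions with a prescribed middle term -/

section Ext

variable {C : Type u} [Category.{v} C] [Abelian C]

/-- `Ext¹(M, N)_L`: the classes in `Ext¹(M, N)` of the short exact sequences
`0 ⟶ N ⟶ L ⟶ M ⟶ 0`. -/
def extMid [HasExt.{w} C] (M N L : C) : Set (Abelian.Ext M N 1) :=
  {e | ∃ (f : N ⟶ L) (g : L ⟶ M) (zero : f ≫ g = 0)
    (h : (ShortComplex.mk f g zero).ShortExact), h.extClass = e}

/-- The morphism underlying an automorphism. -/
def autHom {L : C} (φ : Aut L) : L ⟶ L := Iso.hom (X := L) (Y := L) φ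

/-- The inverse of the morphism underlying an automorphism. -/
def autInv {L : C} (φ : Aut L) : L ⟶ L := Iso.inv (X := L) (Y := L) φ

@[simp]
theorem autHom_inv {L : C} (φ : Aut L) : autHom φ ≫ autInv φ = 𝟙 L := Iso.hom_inv_id (X := L) (Y := L) φ

@[simp]
theorem autInv_hom {L : C} (φ : Aut L) : autInv φ ≫ autHom φ = 𝟙 L := Iso.inv_hom_id (X := L) (Y := L) φ

theorem aut_ext {L : C} {φ ψ : Aut L} (h : autHom φ = autHom ψ) : φ = ψ := Iso.ext h

/-- The automorphism with given morphism and inverse. -/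
def autMk {L : C} (a b : L ⟶ L) (h₁ : a ≫ b = 𝟙 L) (h₂ : b ≫ a = 𝟙 L) : Aut L :=
  (⟨a, b, h₁, h₂⟩ : L ≅ L)

@[simp] theorem autHom_mk {L : C} (a b : L ⟶ L) (h₁ : a ≫ b = 𝟙 L) (h₂ : b ≫ a = 𝟙 L) :
    autHom (autMk a b h₁ h₂) = a := rfl

@[simp] theorem autInv_mk {L : C} (a b : L ⟶ L) (h₁ : a ≫ b = 𝟙 L) (h₂ : b ≫ a = 𝟙 L) :
    autInv (autMk a b h₁ h₂) = b := rfl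

/-- The short exact sequences `0 ⟶ N ⟶ L ⟶ M ⟶ 0` with fixed terms. -/
structure Confl (M N L : C) where
  i : N ⟶ L
  p : L ⟶ M
  zero : i ≫ p = 0
  exact : (ShortComplex.mk i p zero).ShortExact

namespace Confl

variable {M N L : C}

@[ext]
theorem ext' {c d : Confl M N L} (h₁ : c.i = d.i) (h₂ : c.p = d.p) : c = d := by
  cases c; cases d; cases h₁; cases h₂; rfl

theorem zero_conj (c : Confl M N L) (φ : Aut L) : (c.i ≫ autHom φ) ≫ autInv φ ≫ c.p = 0 := by
  rw [Category.assoc, ← Category.assoc (autHom φ), autHom_inv, Category.id_comp, c.zero]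

theorem shortExact_conj (c : Confl M N L) (φ : Aut L) :
    (ShortComplex.mk (c.i ≫ autHom φ) (autInv φ ≫ c.p) (c.zero_conj φ)).ShortExact := by
  let e : ShortComplex.mk c.i c.p c.zero ≅ ShortComplex.mk _ _ (c.zero_conj φ) :=
    ShortComplex.isoMk (Iso.refl N) (φ : L ≅ L) (Iso.refl M)
      (by simp [autHom]) (by
        change autHom φ ≫ autInv φ ≫ c.p = c.p ≫ 𝟙 M
        rw [← Category.assoc, autHom_inv, Category.id_comp, Category.comp_id])
  exact ShortComplex.shortExact_of_iso e c.exact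

/-- `Aut L` acts on the short exact sequences with middle term `L`. -/
instance : MulAction (Aut L) (Confl M N L) where
  smul φ c := ⟨c.i ≫ autHom φ, autInv φ ≫ c.p, c.zero_conj φ, c.shortExact_conj φ⟩
  one_smul c := ext' (Category.comp_id _) (Category.id_comp _)
  mul_smul φ ψ c := ext' (Category.assoc _ _ _).symm (Category.assoc _ _ _)

theorem smul_i (φ : Aut L) (c : Confl M N L) : (φ • c).i = c.i ≫ autHom φ := rfl
theorem smul_p (φ : Aut L) (c : Confl M N L) : (φ • c).p = autInv φ ≫ c.p := rfl

/-- The class of a short exact sequence. -/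
noncomputable def cls [HasExt.{w} C] (c : Confl M N L) : Abelian.Ext M N 1 := c.exact.extClass

theorem cls_eq_iff [HasExt.{w} C] (c d : Confl M N L) :
    c.cls = d.cls ↔ ∃ φ : Aut L, φ • c = d := by
  constructor
  · intro h
    obtain ⟨x, hx⟩ := Abelian.Ext.contravariant_sequence_exact₁ c.exact L
      (Abelian.Ext.mk₀ d.i) (n₁ := 1) rfl (by
        have h' : c.exact.extClass = d.exact.extClass := h
        rw [h']
        exact d.exact.extClass_comp)
    obtain ⟨a, rfl⟩ := Abelian.Ext.addEquiv₀.symm.surjective x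
    have ha : c.i ≫ a = d.i := by
      apply (Abelian.Ext.mk₀_bijective _ _).1
      simpa using hx
    have : Epi c.p := c.exact.epi_g
    have : Epi d.p := d.exact.epi_g
    let u : M ⟶ M := c.exact.exact.desc (a ≫ d.p) (by
      change c.i ≫ a ≫ d.p = 0
      rw [← Category.assoc, ha, d.zero])
    have hu : c.p ≫ u = a ≫ d.p := c.exact.exact.g_desc _ _
    have h1 := ShortComplex.ShortExact.extClass_naturality c.exact d.exact
      (ShortComplex.homMk (𝟙 N) a u (by simp [ha]) (by simp [hu]))
    have h2 : (Abelian.Ext.mk₀ (u - 𝟙 M)).comp d.exact.extClass (zero_add 1) = 0 := by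
      have h' : c.exact.extClass = d.exact.extClass := h
      simp only [ShortComplex.homMk_τ₁, ShortComplex.homMk_τ₃, Abelian.Ext.comp_mk₀_id] at h1
      rw [h'] at h1
      rw [sub_eq_add_neg, Abelian.Ext.mk₀_add, Abelian.Ext.add_comp, Abelian.Ext.mk₀_neg,
        Abelian.Ext.neg_comp, Abelian.Ext.mk₀_id_comp]
      rw [← sub_eq_add_neg, sub_eq_zero]
      exact h1.symm
    obtain ⟨y, hy⟩ := Abelian.Ext.covariant_sequence_exact₃ M d.exact _ rfl h2
    obtain ⟨b, rfl⟩ := Abelian.Ext.addEquiv₀.symm.surjective y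
    have hb : b ≫ d.p = u - 𝟙 M := by
      apply (Abelian.Ext.mk₀_bijective _ _).1
      simpa using hy
    let φ : L ⟶ L := a - c.p ≫ b
    have hφ1 : c.i ≫ φ = d.i := by
      simp only [φ, Preadditive.comp_sub, ha]
      rw [← Category.assoc, c.zero]; simp
    have hφ2 : φ ≫ d.p = c.p := by
      simp [φ, Preadditive.sub_comp, hb, Preadditive.comp_sub, hu]
    let Φ : ShortComplex.mk c.i c.p c.zero ⟶ ShortComplex.mk d.i d.p d.zero :=
      ShortComplex.homMk (𝟙 N) φ (𝟙 M) (by simp [hφ1]) (by simp [hφ2])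
    have h3 : IsIso Φ.τ₁ := inferInstanceAs (IsIso (𝟙 N))
    have h4 : IsIso Φ.τ₃ := inferInstanceAs (IsIso (𝟙 M))
    have : IsIso φ := ShortComplex.isIso₂_of_shortExact_of_isIso₁₃ Φ c.exact d.exact
    refine ⟨autMk φ (inv φ) (IsIso.hom_inv_id φ) (IsIso.inv_hom_id φ), ext' hφ1 ?_⟩
    change inv φ ≫ c.p = d.p
    rw [IsIso.inv_comp_eq, hφ2]
  · rintro ⟨φ, rfl⟩
    have h1 := ShortComplex.ShortExact.extClass_naturality c.exact (φ • c).exact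
      (ShortComplex.homMk (𝟙 N) (autHom φ) (𝟙 M) (by simp [smul_i]) (by
        change autHom φ ≫ autInv φ ≫ c.p = c.p ≫ 𝟙 M
        rw [← Category.assoc, autHom_inv, Category.id_comp, Category.comp_id]))
    simp only [ShortComplex.homMk_τ₁, ShortComplex.homMk_τ₃] at h1
    rw [Abelian.Ext.comp_mk₀_id, Abelian.Ext.mk₀_id_comp] at h1
    exact h1

/-- Two extensions with middle term `L` have the same class iff they lie in one `Aut L`-orbit. -/
noncomputable def orbitsEquivExtMid [HasExt.{w} C] (M N L : C) :
    MulAction.orbitRel.Quotient (Aut L) (Confl M N L) ≃ extMid M N L :=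
  Equiv.ofBijective
    (fun o => Quotient.liftOn' o (fun c => (⟨c.cls, c.i, c.p, c.zero, c.exact, rfl⟩ : extMid M N L))
      (by
        rintro c d ⟨φ, rfl⟩
        exact Subtype.ext ((cls_eq_iff _ _).2 ⟨φ, rfl⟩).symm))
    (by
      constructor
      · rintro ⟨c⟩ ⟨d⟩ h
        obtain ⟨φ, rfl⟩ := (cls_eq_iff c d).1 (congrArg Subtype.val h)
        exact (Quotient.sound' (⟨φ, rfl⟩ : MulAction.orbitRel (Aut L) _ (φ • c) c)).symm
      · rintro ⟨_, f, g, z, h, rfl⟩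
        exact ⟨Quotient.mk'' ⟨f, g, z, h⟩, rfl⟩)

theorem mem_stabilizer_iff (c : Confl M N L) (φ : Aut L) :
    φ ∈ MulAction.stabilizer (Aut L) c ↔ c.i ≫ autHom φ = c.i ∧ autHom φ ≫ c.p = c.p := by
  rw [MulAction.mem_stabilizer_iff]
  constructor
  · intro h
    refine ⟨congrArg Confl.i h, ?_⟩
    have h' : autInv φ ≫ c.p = c.p := congrArg Confl.p h
    conv_lhs => rw [← h', ← Category.assoc, autHom_inv, Category.id_comp]
  · rintro ⟨h₁, h₂⟩
    refine ext' h₁ ?_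
    change autInv φ ≫ c.p = c.p
    conv_lhs => rw [← h₂, ← Category.assoc, autInv_hom, Category.id_comp]

/-- The automorphism `1 + p h i` attached to `h : M ⟶ N`. -/
def stab (c : Confl M N L) (h : M ⟶ N) : Aut L :=
  autMk (𝟙 L + c.p ≫ h ≫ c.i) (𝟙 L - c.p ≫ h ≫ c.i)
    (by simp [reassoc_of% c.zero]) (by simp [reassoc_of% c.zero])

theorem stab_mem (c : Confl M N L) (h : M ⟶ N) : c.stab h ∈ MulAction.stabilizer (Aut L) c := by
  rw [mem_stabilizer_iff]
  constructor
  · simp [stab, reassoc_of% c.zero]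
  · simp [stab, c.zero]

/-- The stabilizer of a short exact sequence in `Aut L` is a copy of `Hom(M, N)`. -/
noncomputable def homEquivStabilizer (c : Confl M N L) :
    (M ⟶ N) ≃ MulAction.stabilizer (Aut L) c :=
  Equiv.ofBijective (fun h => ⟨c.stab h, c.stab_mem h⟩) (by
    have : Mono c.i := c.exact.mono_f
    have : Epi c.p := c.exact.epi_g
    constructor
    · intro h h' e
      have e' : 𝟙 L + c.p ≫ h ≫ c.i = 𝟙 L + c.p ≫ h' ≫ c.i :=
        congrArg (fun x => autHom (Subtype.val x)) e
      rw [add_right_inj, cancel_epi, cancel_mono] at e'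
      exact e'
    · rintro ⟨φ, hφ⟩
      obtain ⟨h₁, h₂⟩ := (mem_stabilizer_iff c φ).1 hφ
      let l : L ⟶ N := c.exact.exact.lift (autHom φ - 𝟙 L) (by
        change (autHom φ - 𝟙 L) ≫ c.p = 0
        rw [Preadditive.sub_comp, h₂, Category.id_comp, sub_self])
      have hl : l ≫ c.i = autHom φ - 𝟙 L := c.exact.exact.lift_f _ _
      let d : M ⟶ N := c.exact.exact.desc l (by
        change c.i ≫ l = 0
        rw [← cancel_mono c.i, Category.assoc, hl, Preadditive.comp_sub, h₁, Category.comp_id,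
          sub_self, Limits.zero_comp])
      have hd : c.p ≫ d = l := c.exact.exact.g_desc _ _
      refine ⟨d, Subtype.ext (aut_ext ?_)⟩
      change 𝟙 L + c.p ≫ d ≫ c.i = autHom φ
      rw [← Category.assoc, hd, hl]
      abel)

/-- The count of short exact sequences behind the Riedtmann-Peng formula. -/
theorem card_extMid_mul [HasExt.{w} C] (M N L : C) :
    Nat.card (extMid M N L) * Nat.card (Aut L) = Nat.card (Confl M N L) * Nat.card (M ⟶ N) := by
  rw [← Nat.card_congr (orbitsEquivExtMid M N L), ← Nat.card_prod, ← Nat.card_prod]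
  refine (Nat.card_congr (MulAction.sigmaFixedByEquivOrbitsProdGroup (Aut L) (Confl M N L))).symm.trans ?_
  refine Nat.card_congr ?_
  calc (Σ g : Aut L, MulAction.fixedBy (Confl M N L) g)
      ≃ {ab : Aut L × Confl M N L // ab.1 • ab.2 = ab.2} :=
        (Equiv.subtypeProdEquivSigmaSubtype fun (g : Aut L) (c : Confl M N L) => g • c = c).symm
    _ ≃ {ba : Confl M N L × Aut L // ba.2 • ba.1 = ba.1} :=
        (Equiv.prodComm _ _).subtypeEquiv fun _ => Iff.rfl
    _ ≃ Σ c : Confl M N L, MulAction.stabilizer (Aut L) c :=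
        Equiv.subtypeProdEquivSigmaSubtype fun (c : Confl M N L) a => a ∈ MulAction.stabilizer (Aut L) c
    _ ≃ Σ _ : Confl M N L, (M ⟶ N) := Equiv.sigmaCongrRight fun c => (homEquivStabilizer c).symm
    _ ≃ Confl M N L × (M ⟶ N) := Equiv.sigmaEquivProd _ _

end Confl

end Ext


/-! ### Finite modules over a finite ring -/

section Modules

variable {A : Type u} [Ring A] [Finite A]

instance : HasExt.{u + 1} (FGModuleCat.{u} A) := HasExt.standard _

instance (M : FGModuleCat.{u} A) : Finite M := Module.finite_of_finite A

/-- The submodules `X` of `L` with `X ≅ N` and `L / X ≅ M`. -/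
def hallSub (A : Type u) [Ring A] (M N L : Type u) [AddCommGroup M] [Module A M] [AddCommGroup N]
    [Module A N] [AddCommGroup L] [Module A L] : Set (Submodule A L) :=
  {X | Nonempty (X ≃ₗ[A] N) ∧ Nonempty ((L ⧸ X) ≃ₗ[A] M)}

theorem shortExact_iff {M N L : FGModuleCat.{u} A} (f : N ⟶ L) (g : L ⟶ M) (w : f ≫ g = 0) :
    (ShortComplex.mk f g w).ShortExact ↔ Function.Injective f.hom.hom ∧
      LinearMap.range f.hom.hom = LinearMap.ker g.hom.hom ∧ Function.Surjective g.hom.hom := by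
  rw [← ShortExact.shortExact_map_iff (F := forget₂ (FGModuleCat.{u} A) (ModuleCat.{u} A))]
  constructor
  · intro h
    exact ⟨h.moduleCat_injective_f, h.exact.moduleCat_range_eq_ker, h.moduleCat_surjective_g⟩
  · rintro ⟨h₁, h₂, h₃⟩
    refine ModuleCat.shortComplex_shortExact _ ?_ h₁ h₃
    exact LinearMap.exact_iff.2 h₂.symm

/-- The short exact sequence given by a submodule with two identifications. -/
def conflMk {M N L : FGModuleCat.{u} A} (X : Submodule A L) (e : N ≃ₗ[A] X) (e' : (L ⧸ X) ≃ₗ[A] M) :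
    Confl M N L where
  i := FGModuleCat.ofHom (X.subtype ∘ₗ e.toLinearMap)
  p := FGModuleCat.ofHom (e'.toLinearMap ∘ₗ X.mkQ)
  zero := by
    ext x
    change e' (X.mkQ (e x : L)) = 0
    have h : X.mkQ (e x : L) = 0 := (Submodule.Quotient.mk_eq_zero X).2 (e x).2
    rw [h, map_zero]
  exact := by
    rw [shortExact_iff]
    refine ⟨?_, ?_, ?_⟩
    · exact X.subtype_injective.comp e.injective
    · change LinearMap.range (X.subtype ∘ₗ e.toLinearMap) = LinearMap.ker (e'.toLinearMap ∘ₗ X.mkQ)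
      rw [LinearEquiv.range_comp, LinearEquiv.ker_comp]
      simp
    · exact e'.surjective.comp X.mkQ_surjective

theorem conflMk_bijective (M N L : FGModuleCat.{u} A) :
    Function.Bijective (fun s : (Σ X : hallSub A M N L, (N ≃ₗ[A] X.1) × ((L ⧸ X.1) ≃ₗ[A] M)) =>
      (conflMk s.1.1 s.2.1 s.2.2 : Confl M N L)) := by
  constructor
  · rintro ⟨⟨X, hX⟩, e, e'⟩ ⟨⟨Y, hY⟩, d, d'⟩ h
    have h1 : X.subtype ∘ₗ e.toLinearMap = Y.subtype ∘ₗ d.toLinearMap :=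
      congrArg (fun c : Confl M N L => c.i.hom.hom) h
    have h2 : e'.toLinearMap ∘ₗ X.mkQ = d'.toLinearMap ∘ₗ Y.mkQ :=
      congrArg (fun c : Confl M N L => c.p.hom.hom) h
    have hXY : X = Y := by
      have := congrArg LinearMap.range h1
      rwa [LinearEquiv.range_comp, LinearEquiv.range_comp, Submodule.range_subtype,
        Submodule.range_subtype] at this
    subst hXY
    have h3 : e = d := by
      ext x
      exact LinearMap.congr_fun h1 x
    have h4 : e' = d' := by
      ext x
      obtain ⟨x, rfl⟩ := X.mkQ_surjective x
      exact LinearMap.congr_fun h2 x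
    subst h3 h4
    rfl
  · intro c
    obtain ⟨h₁, h₂, h₃⟩ := (shortExact_iff c.i c.p c.zero).1 c.exact
    let e : N ≃ₗ[A] LinearMap.range c.i.hom.hom := LinearEquiv.ofInjective _ h₁
    let e' : (L ⧸ LinearMap.range c.i.hom.hom) ≃ₗ[A] M :=
      (Submodule.quotEquivOfEq _ _ h₂).trans (LinearMap.quotKerEquivOfSurjective _ h₃)
    refine ⟨⟨⟨LinearMap.range c.i.hom.hom, ⟨e.symm⟩, ⟨e'⟩⟩, e, e'⟩, Confl.ext' ?_ ?_⟩
    · ext x; rfl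
    · ext x; rfl

/-- Automorphisms in the category are the linear automorphisms. -/
def autEquiv (L : FGModuleCat.{u} A) : Aut L ≃ (L ≃ₗ[A] L) where
  toFun φ := FGModuleCat.isoToLinearEquiv φ
  invFun e := e.toFGModuleCatIso
  left_inv _ := rfl
  right_inv _ := rfl

/-- Morphisms in the category are the linear maps. -/
def homEquiv (M N : FGModuleCat.{u} A) : (M ⟶ N) ≃ (M →ₗ[A] N) where
  toFun f := f.hom.hom
  invFun f := FGModuleCat.ofHom f
  left_inv _ := rfl
  right_inv _ := rfl

theorem card_confl (M N L : FGModuleCat.{u} A) :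
    Nat.card (Confl M N L) =
      Nat.card (hallSub A M N L) * Nat.card (M ≃ₗ[A] M) * Nat.card (N ≃ₗ[A] N) := by
  rw [← Nat.card_congr (Equiv.ofBijective _ (conflMk_bijective M N L)), mul_assoc, ← Nat.card_prod,
    ← Nat.card_prod]
  refine Nat.card_congr ((Equiv.sigmaCongrRight fun X => ?_).trans (Equiv.sigmaEquivProd _ _))
  let a := X.2.1.some
  let b := X.2.2.some
  exact
    { toFun := fun s => (b.symm.trans s.2, s.1.trans a)
      invFun := fun s => (s.2.trans a.symm, b.trans s.1)
      left_inv := fun s => by ext <;> simp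
      right_inv := fun s => by ext <;> simp }

/-- The Riedtmann-Peng formula. -/
theorem card_extMid (M N L : FGModuleCat.{u} A) :
    Nat.card (extMid M N L) * Nat.card (L ≃ₗ[A] L) =
      Nat.card (hallSub A M N L) * Nat.card (M ≃ₗ[A] M) * Nat.card (N ≃ₗ[A] N) *
        Nat.card (M →ₗ[A] N) := by
  rw [← Nat.card_congr (autEquiv L), Confl.card_extMid_mul, card_confl,
    Nat.card_congr (homEquiv M N)]

/-! ### Isomorphism classes -/

/-- `Iso(mod A)`: the isomorphism classes of finitely generated `A`-modules. -/
def IsoClass (A : Type u) [Ring A] : Type (u + 1) := Quotient (isIsomorphicSetoid (FGModuleCat.{u} A))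

/-- The isomorphism class of a module. -/
def IsoClass.mk (A : Type u) [Ring A] (M : Type u) [AddCommGroup M] [Module A M]
    [Module.Finite A M] : IsoClass A :=
  Quotient.mk _ (FGModuleCat.of A M)

/-- A chosen module in an isomorphism class. -/
noncomputable def IsoClass.rep {A : Type u} [Ring A] (X : IsoClass A) : FGModuleCat.{u} A :=
  Quotient.out X

theorem IsoClass.mk_eq_mk_iff {M N : Type u} [AddCommGroup M] [Module A M] [Module.Finite A M]
    [AddCommGroup N] [Module A N] [Module.Finite A N] :
    IsoClass.mk A M = IsoClass.mk A N ↔ Nonempty (M ≃ₗ[A] N) := by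
  constructor
  · intro h
    obtain ⟨i⟩ : Nonempty (FGModuleCat.of A M ≅ FGModuleCat.of A N) := Quotient.exact h
    exact ⟨FGModuleCat.isoToLinearEquiv i⟩
  · rintro ⟨e⟩
    exact Quotient.sound ⟨e.toFGModuleCatIso⟩

theorem IsoClass.mk_rep (X : IsoClass A) : IsoClass.mk A X.rep = X := Quotient.out_eq X

theorem IsoClass.rep_mk (M : Type u) [AddCommGroup M] [Module A M] [Module.Finite A M] :
    Nonempty ((IsoClass.mk A M).rep ≃ₗ[A] M) :=
  IsoClass.mk_eq_mk_iff.1 (IsoClass.mk_rep _)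

theorem IsoClass.eq_mk_iff {X : IsoClass A} {M : Type u} [AddCommGroup M] [Module A M]
    [Module.Finite A M] : X = IsoClass.mk A M ↔ Nonempty (X.rep ≃ₗ[A] M) := by
  rw [← IsoClass.mk_eq_mk_iff, IsoClass.mk_rep]

/-- The structure constant `|Ext¹(X, Y)_Z| / |Hom(X, Y)|`. -/
noncomputable def hallCoeff (X Y Z : IsoClass A) : ℚ :=
  Nat.card (extMid X.rep Y.rep Z.rep) / Nat.card (X.rep ⟶ Y.rep)

/-- The Hall number: the number of submodules of `Z` in the class `Y` with quotient in `X`. -/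
noncomputable def hallNum (X Y Z : IsoClass A) : ℕ := Nat.card (hallSub A X.rep Y.rep Z.rep)

/-- The order of the automorphism group. -/
noncomputable def autNum (X : IsoClass A) : ℕ := Nat.card (X.rep ≃ₗ[A] X.rep)

theorem finite_linearEquiv (M N : Type u) [AddCommGroup M] [Module A M] [AddCommGroup N]
    [Module A N] [Finite M] [Finite N] : Finite (M ≃ₗ[A] N) :=
  Finite.of_injective (fun e => (e : M → N)) DFunLike.coe_injective

theorem finite_linearMap (M N : Type u) [AddCommGroup M] [Module A M] [AddCommGroup N]
    [Module A N] [Finite M] [Finite N] : Finite (M →ₗ[A] N) :=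
  Finite.of_injective (fun e => (e : M → N)) DFunLike.coe_injective

theorem autNum_ne_zero (X : IsoClass A) : (autNum X : ℚ) ≠ 0 := by
  have := finite_linearEquiv (A := A) X.rep X.rep
  exact Nat.cast_ne_zero.2 (Nat.card_pos (α := X.rep ≃ₗ[A] X.rep)).ne'

theorem hallCoeff_eq (X Y Z : IsoClass A) :
    hallCoeff X Y Z = hallNum X Y Z * autNum X * autNum Y / autNum Z := by
  have h := card_extMid X.rep Y.rep Z.rep
  have := finite_linearMap (A := A) X.rep Y.rep
  have h0 : (Nat.card (X.rep →ₗ[A] Y.rep) : ℚ) ≠ 0 := Nat.cast_ne_zero.2 Nat.card_pos.ne'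
  have hZ := autNum_ne_zero Z
  rw [hallCoeff, Nat.card_congr (homEquiv X.rep Y.rep), div_eq_div_iff h0 hZ]
  unfold hallNum autNum
  exact_mod_cast h

theorem hallSub_congr {M N L M' N' L' : Type u} [AddCommGroup M] [Module A M] [AddCommGroup N]
    [Module A N] [AddCommGroup L] [Module A L] [AddCommGroup M'] [Module A M'] [AddCommGroup N']
    [Module A N'] [AddCommGroup L'] [Module A L'] (eM : M ≃ₗ[A] M') (eN : N ≃ₗ[A] N')
    (eL : L ≃ₗ[A] L') : Nat.card (hallSub A M N L) = Nat.card (hallSub A M' N' L') := by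
  refine Nat.card_congr ((Submodule.orderIsoMapComap eL).toEquiv.subtypeEquiv fun X => ?_)
  have h1 : X ≃ₗ[A] X.map (eL : L →ₗ[A] L') := eL.submoduleMap X
  have h2 : (L ⧸ X) ≃ₗ[A] (L' ⧸ X.map (eL : L →ₗ[A] L')) := Submodule.Quotient.equiv _ _ eL rfl
  constructor
  · rintro ⟨⟨a⟩, ⟨b⟩⟩
    exact ⟨⟨(h1.symm.trans a).trans eN⟩, ⟨(h2.symm.trans b).trans eM⟩⟩
  · rintro ⟨⟨a⟩, ⟨b⟩⟩
    exact ⟨⟨(h1.trans a).trans eN.symm⟩, ⟨(h2.trans b).trans eM.symm⟩⟩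

theorem hallNum_mk (M N L : Type u) [AddCommGroup M] [Module A M] [Module.Finite A M]
    [AddCommGroup N] [Module A N] [Module.Finite A N] [AddCommGroup L] [Module A L]
    [Module.Finite A L] :
    hallNum (IsoClass.mk A M) (IsoClass.mk A N) (IsoClass.mk A L) = Nat.card (hallSub A M N L) :=
  hallSub_congr (IsoClass.rep_mk M).some (IsoClass.rep_mk N).some (IsoClass.rep_mk L).some

theorem hallSub_card {M N L : Type u} [AddCommGroup M] [Module A M] [AddCommGroup N] [Module A N]
    [AddCommGroup L] [Module A L] (X : hallSub A M N L) :
    Nat.card L = Nat.card M * Nat.card N := by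
  rw [Submodule.card_eq_card_quotient_mul_card X.1, Nat.card_congr X.2.1.some.toEquiv,
    Nat.card_congr X.2.2.some.toEquiv, mul_comm]

/-- There are finitely many isomorphism classes of modules of a given order. -/
theorem finite_isoClass (n : ℕ) : {Z : IsoClass A | Nat.card Z.rep = n}.Finite := by
  have : Finite (Submodule A (Fin n → A)) :=
    Finite.of_injective (fun S => (S : Set (Fin n → A))) SetLike.coe_injective
  refine (Set.finite_range fun S : Submodule A (Fin n → A) =>
    IsoClass.mk A ((Fin n → A) ⧸ S)).subset ?_
  intro Z hZ
  let e : Z.rep ≃ Fin n := Finite.equivFinOfCardEq hZ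
  let f : (Fin n → A) →ₗ[A] Z.rep := Fintype.linearCombination A fun i => e.symm i
  have hf : Function.Surjective f := by
    intro z
    refine ⟨Pi.single (e z) 1, ?_⟩
    simp [f, Fintype.linearCombination_apply_single]
  refine ⟨LinearMap.ker f, ?_⟩
  exact (IsoClass.eq_mk_iff.2 ⟨(LinearMap.quotKerEquivOfSurjective f hf).symm⟩).symm

theorem hallNum_finite (X Y : IsoClass A) : {Z : IsoClass A | hallNum X Y Z ≠ 0}.Finite := by
  refine (finite_isoClass (A := A) (Nat.card X.rep * Nat.card Y.rep)).subset ?_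
  intro Z hZ
  have : Nonempty (hallSub A X.rep Y.rep Z.rep) := (Nat.card_ne_zero.1 hZ).1
  exact hallSub_card this.some

theorem hallCoeff_ne_zero_iff (X Y Z : IsoClass A) : hallCoeff X Y Z ≠ 0 ↔ hallNum X Y Z ≠ 0 := by
  rw [hallCoeff_eq, div_ne_zero_iff, mul_ne_zero_iff, mul_ne_zero_iff, Nat.cast_ne_zero]
  simp only [autNum_ne_zero, ne_eq, not_false_eq_true, and_true]

theorem hallCoeff_finite (X Y : IsoClass A) : {Z : IsoClass A | hallCoeff X Y Z ≠ 0}.Finite := by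
  simpa only [hallCoeff_ne_zero_iff] using hallNum_finite X Y

theorem hallNum_finite' (Y Z : IsoClass A) : {X : IsoClass A | hallNum X Y Z ≠ 0}.Finite := by
  have hfin : Finite (Submodule A Z.rep) :=
    Finite.of_injective (fun S => (S : Set Z.rep)) SetLike.coe_injective
  refine (Set.finite_range fun S : Submodule A Z.rep => IsoClass.mk A (Z.rep ⧸ S)).subset ?_
  intro X hX
  have h : Nonempty (hallSub A X.rep Y.rep Z.rep) := (Nat.card_ne_zero.1 hX).1
  obtain ⟨S, hS⟩ := h.some
  exact ⟨S, (IsoClass.eq_mk_iff.2 ⟨hS.2.some.symm⟩).symm⟩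

/-- Flags `V₁ ≤ V₂ ≤ W` with subquotients `Z`, `Y`, `X` (from the bottom). -/
def flags (A : Type u) [Ring A] (X Y Z W : Type u) [AddCommGroup X] [Module A X] [AddCommGroup Y]
    [Module A Y] [AddCommGroup Z] [Module A Z] [AddCommGroup W] [Module A W] :
    Set (Submodule A W × Submodule A W) :=
  {V | V.1 ≤ V.2 ∧ Nonempty (V.1 ≃ₗ[A] Z) ∧ Nonempty ((V.2 ⧸ V.1.submoduleOf V.2) ≃ₗ[A] Y) ∧
    Nonempty ((W ⧸ V.2) ≃ₗ[A] X)}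

section flags

variable {X Y Z W : Type u} [AddCommGroup X] [Module A X] [AddCommGroup Y]
    [Module A Y] [AddCommGroup Z] [Module A Z] [AddCommGroup W] [Module A W]

/-- The image of `U` in `W / V` is a copy of `U / (U ∩ V)`. -/
noncomputable def mapMkQEquiv {V U : Submodule A W} :
    (U ⧸ V.submoduleOf U) ≃ₗ[A] U.map V.mkQ :=
  (Submodule.quotEquivOfEq _ _ (by
    rw [LinearMap.ker_comp, Submodule.ker_mkQ]; rfl)).trans
    ((LinearMap.quotKerEquivRange (V.mkQ ∘ₗ U.subtype)).trans
      (LinearEquiv.ofEq _ _ (by rw [LinearMap.range_comp, Submodule.range_subtype])))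

/-- A flag is a bottom submodule and a submodule of the quotient. -/
noncomputable def flagsEquivBot :
    flags A X Y Z W ≃ Σ V : {V : Submodule A W // Nonempty (V ≃ₗ[A] Z)}, hallSub A X Y (W ⧸ V.1) where
  toFun F := ⟨⟨F.1.1, F.2.2.1⟩, F.1.2.map F.1.1.mkQ,
    ⟨mapMkQEquiv.symm.trans F.2.2.2.1.some⟩,
    ⟨(Submodule.quotientQuotientEquivQuotient F.1.1 F.1.2 F.2.1).trans F.2.2.2.2.some⟩⟩
  invFun s := ⟨(s.1.1, s.2.1.comap s.1.1.mkQ), Submodule.le_comap_mkQ _ _, s.1.2, by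
      have h : (s.2.1.comap s.1.1.mkQ).map s.1.1.mkQ = s.2.1 :=
        Submodule.map_comap_eq_of_surjective (Submodule.mkQ_surjective _) _
      exact ⟨⟨mapMkQEquiv.trans ((LinearEquiv.ofEq _ _ h).trans s.2.2.1.some)⟩,
        ⟨(Submodule.quotientQuotientEquivQuotient s.1.1 _ (Submodule.le_comap_mkQ _ _)).symm.trans
          ((Submodule.quotEquivOfEq _ _ h).trans s.2.2.2.some)⟩⟩⟩
  left_inv F := by
    apply Subtype.ext
    apply Prod.ext
    · rfl
    · change (F.1.2.map F.1.1.mkQ).comap F.1.1.mkQ = F.1.2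
      rw [Submodule.comap_map_eq, Submodule.ker_mkQ]
      exact sup_eq_left.2 F.2.1
  right_inv s := by
    obtain ⟨V, U, hU⟩ := s
    have h : (U.comap V.1.mkQ).map V.1.mkQ = U :=
      Submodule.map_comap_eq_of_surjective (Submodule.mkQ_surjective _) _
    exact Sigma.ext rfl (heq_of_eq (Subtype.ext h))

/-- A flag is a top submodule and a submodule of it. -/
noncomputable def flagsEquivTop :
    flags A X Y Z W ≃ Σ V : {V : Submodule A W // Nonempty ((W ⧸ V) ≃ₗ[A] X)}, hallSub A Y Z V.1 where
  toFun F := ⟨⟨F.1.2, F.2.2.2.2⟩, F.1.1.submoduleOf F.1.2,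
    ⟨(Submodule.submoduleOfEquivOfLe F.2.1).trans F.2.2.1.some⟩, F.2.2.2.1⟩
  invFun s := ⟨(s.2.1.map s.1.1.subtype, s.1.1), Submodule.map_subtype_le _ _, by
      have h : (s.2.1.map s.1.1.subtype).submoduleOf s.1.1 = s.2.1 :=
        Submodule.comap_map_eq_of_injective (Submodule.subtype_injective _) _
      exact ⟨⟨(Submodule.equivMapOfInjective _ (Submodule.subtype_injective _) s.2.1).symm.trans
          s.2.2.1.some⟩, ⟨(Submodule.quotEquivOfEq _ _ h).trans s.2.2.2.some⟩, s.1.2⟩⟩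
  left_inv F := by
    apply Subtype.ext
    apply Prod.ext
    · change (F.1.1.comap F.1.2.subtype).map F.1.2.subtype = F.1.1
      rw [Submodule.map_comap_eq, Submodule.range_subtype]
      exact inf_eq_right.2 F.2.1
    · rfl
  right_inv s := by
    obtain ⟨V, U, hU⟩ := s
    have h : (U.map V.1.subtype).comap V.1.subtype = U :=
      Submodule.comap_map_eq_of_injective (Submodule.subtype_injective _) _
    exact Sigma.ext rfl (heq_of_eq (Subtype.ext h))

end flags

/-- Counting a family of finite sets over a finite type along its isomorphism classes. -/
theorem card_sigma_eq_finsum {ι : Type u} [Finite ι] (g : ι → IsoClass A) (β : ι → Type u)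
    [∀ i, Finite (β i)] (f : IsoClass A → ℕ) (hf : ∀ i, Nat.card (β i) = f (g i)) :
    Nat.card (Σ i, β i) = ∑ᶠ U, Nat.card {i // g i = U} * f U := by
  classical
  have := Fintype.ofFinite ι
  rw [Nat.card_sigma]
  simp_rw [hf]
  rw [Finset.sum_comp f g]
  rw [finsum_eq_sum_of_support_subset (s := Finset.univ.image g)]
  · refine Finset.sum_congr rfl fun U _ => ?_
    rw [Nat.card_eq_fintype_card, Fintype.card_subtype, smul_eq_mul]
  · intro U hU
    have h1 : Nat.card {i // g i = U} ≠ 0 := left_ne_zero_of_mul hU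
    obtain ⟨i, hi⟩ := (Nat.card_ne_zero.1 h1).1
    simpa using ⟨i, hi⟩

theorem hallNum_assoc (X Y Z W : IsoClass A) :
    ∑ᶠ U, hallNum X Y U * hallNum U Z W = ∑ᶠ U, hallNum X U W * hallNum Y Z U := by
  have hfin (M : FGModuleCat.{u} A) : Finite (Submodule A M) :=
    Finite.of_injective (fun S => (S : Set M)) SetLike.coe_injective
  have hW := hfin W.rep
  have hsub (V : Submodule A W.rep) : Finite (Submodule A V) :=
    Finite.of_injective (fun S => (S : Set V)) SetLike.coe_injective
  have hquo (V : Submodule A W.rep) : Finite (Submodule A (W.rep ⧸ V)) :=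
    have : Finite (W.rep ⧸ V) := Finite.of_surjective _ V.mkQ_surjective
    Finite.of_injective (fun S => (S : Set (W.rep ⧸ V))) SetLike.coe_injective
  have h1 := card_sigma_eq_finsum (A := A)
    (ι := {V : Submodule A W.rep // Nonempty (V ≃ₗ[A] Z.rep)})
    (fun V => IsoClass.mk A (W.rep ⧸ V.1)) (fun V => hallSub A X.rep Y.rep (W.rep ⧸ V.1))
    (fun U => hallNum X Y U) (fun V => by
      rw [← hallNum_mk, IsoClass.mk_rep, IsoClass.mk_rep])
  have h2 := card_sigma_eq_finsum (A := A)
    (ι := {V : Submodule A W.rep // Nonempty ((W.rep ⧸ V) ≃ₗ[A] X.rep)})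
    (fun V => IsoClass.mk A V.1) (fun V => hallSub A Y.rep Z.rep V.1)
    (fun U => hallNum Y Z U) (fun V => by
      rw [← hallNum_mk, IsoClass.mk_rep, IsoClass.mk_rep])
  rw [← Nat.card_congr flagsEquivBot] at h1
  rw [← Nat.card_congr flagsEquivTop, h1] at h2
  have e1 (U : IsoClass A) : hallNum U Z W =
      Nat.card {i : {V : Submodule A W.rep // Nonempty (V ≃ₗ[A] Z.rep)} //
        IsoClass.mk A (W.rep ⧸ i.1) = U} := by
    refine Nat.card_congr
      { toFun := fun V => ⟨⟨V.1, V.2.1⟩, (IsoClass.eq_mk_iff.2 ⟨V.2.2.some.symm⟩).symm⟩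
        invFun := fun i => ⟨i.1.1, i.1.2, ⟨(IsoClass.eq_mk_iff.1 i.2.symm).some.symm⟩⟩
        left_inv := fun _ => rfl
        right_inv := fun _ => rfl }
  have e2 (U : IsoClass A) : hallNum X U W =
      Nat.card {i : {V : Submodule A W.rep // Nonempty ((W.rep ⧸ V) ≃ₗ[A] X.rep)} //
        IsoClass.mk A i.1 = U} := by
    refine Nat.card_congr
      { toFun := fun V => ⟨⟨V.1, V.2.2⟩, (IsoClass.eq_mk_iff.2 ⟨V.2.1.some.symm⟩).symm⟩
        invFun := fun i => ⟨i.1.1, ⟨(IsoClass.eq_mk_iff.1 i.2.symm).some.symm⟩, i.1.2⟩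
        left_inv := fun _ => rfl
        right_inv := fun _ => rfl }
  simp_rw [e1, e2, mul_comm (hallNum X Y _)]
  exact h2

end Modules

/-! ### The twisted Hall algebra of `𝐤[x]/(x²)` -/

section Twisted

/-- The field `ℚ(𝐯)` with `𝐯 = √q`. -/
abbrev QSqrt (q : ℕ) : Type := IntermediateField.adjoin ℚ {Real.sqrt q}

/-- `𝐯 = √q`. -/
noncomputable def sqrtGen (q : ℕ) : QSqrt q := IntermediateField.AdjoinSimple.gen ℚ (Real.sqrt q)

variable (k : Type u) [Field k]

/-- The `ı`quiver algebra `𝐤[x]/(x²)`. -/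
abbrev Lam : Type u := DualNumber k

instance [Finite k] : Finite (Lam k) := inferInstanceAs (Finite (k × k))

variable [Finite k]

/-- `𝐯 = √q` with `q = |𝐤|`, in the field `ℚ(𝐯)`. -/
noncomputable def vv : QSqrt (Nat.card k) := sqrtGen (Nat.card k)

theorem vv_ne_zero : vv k ≠ 0 := by
  intro h
  have h1 : Real.sqrt (Nat.card k) = 0 := congrArg Subtype.val h
  rw [Real.sqrt_eq_zero (Nat.cast_nonneg _), Nat.cast_eq_zero] at h1
  exact (Nat.card_pos (α := k)).ne' h1

variable {k}

/-- The restriction functor from modules over `𝐤[x]/(x²)` to modules over `𝐤`, the path algebra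
of the quiver with one vertex and no arrow. -/
noncomputable abbrev res (M : FGModuleCat.{u} (Lam k)) : ModuleCat.{u} k :=
  (ModuleCat.restrictScalars (algebraMap k (Lam k))).obj M.obj

/-- The Euler form `⟨res M, res N⟩_Q = dim Hom(res M, res N) - dim Ext¹(res M, res N)`. -/
noncomputable def euler (M N : FGModuleCat.{u} (Lam k)) : ℤ :=
  (Module.finrank k (res M ⟶ res N) : ℤ) - Module.finrank k (Abelian.Ext (res M) (res N) 1)

instance (M : FGModuleCat.{u} (Lam k)) : Module.Finite k (res M) := by
  have : Finite (res M) := inferInstanceAs (Finite M)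
  infer_instance

theorem euler_eq (M N : FGModuleCat.{u} (Lam k)) :
    euler M N = Module.finrank k (res M) * Module.finrank k (res N) := by
  have : Subsingleton (Abelian.Ext (res M) (res N) 1) := by
    have : Projective (res M) := ModuleCat.projective_of_free (Module.Basis.ofVectorSpace k (res M))
    exact ⟨fun a b => (Abelian.Ext.eq_zero_of_projective a).trans
      (Abelian.Ext.eq_zero_of_projective b).symm⟩
  rw [euler, Module.finrank_zero_of_subsingleton (M := Abelian.Ext (res M) (res N) 1),
    LinearEquiv.finrank_eq (ModuleCat.homLinearEquiv (S := k) (M := res M) (N := res N)),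
    Module.finrank_linearMap]
  simp

theorem card_rep (M : FGModuleCat.{u} (Lam k)) :
    Nat.card M = Nat.card k ^ Module.finrank k (res M) :=
  Module.natCard_eq_pow_finrank (K := k) (V := res M)

/-- The dimension of a class. -/
noncomputable def cdim (X : IsoClass (Lam k)) : ℕ := Module.finrank k (res X.rep)

theorem cdim_add {X Y Z : IsoClass (Lam k)} (h : hallNum X Y Z ≠ 0) :
    cdim Z = cdim X + cdim Y := by
  have h1 : Nonempty (hallSub (Lam k) X.rep Y.rep Z.rep) := (Nat.card_ne_zero.1 h).1
  have h2 := hallSub_card h1.some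
  rw [card_rep, card_rep, card_rep, ← pow_add] at h2
  exact Nat.pow_right_injective (Finite.one_lt_card (α := k)) h2

variable (k)

/-- The twisted Hall algebra over `ℚ(𝐯)`: the vector space with basis the isomorphism classes. -/
def TwistedHall : Type (u + 1) := IsoClass (Lam k) →₀ QSqrt (Nat.card k)

noncomputable instance : AddCommGroup (TwistedHall k) :=
  inferInstanceAs (AddCommGroup (IsoClass (Lam k) →₀ QSqrt (Nat.card k)))

noncomputable instance : Module (QSqrt (Nat.card k)) (TwistedHall k) :=
  inferInstanceAs (Module (QSqrt (Nat.card k)) (IsoClass (Lam k) →₀ QSqrt (Nat.card k)))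

variable {k}

/-- The basis vector `[X]`. -/
noncomputable def basisVec (X : IsoClass (Lam k)) : TwistedHall k := Finsupp.single X 1

/-- `[X] * [Y] = 𝐯^⟨res X, res Y⟩ ∑_Z (|Ext¹(X, Y)_Z| / |Hom(X, Y)|) [Z]`. -/
noncomputable def hallProd (X Y : IsoClass (Lam k)) : TwistedHall k :=
  Finsupp.ofSupportFinite
    (fun Z => vv k ^ euler X.rep Y.rep * ((hallCoeff X Y Z : ℚ) : QSqrt (Nat.card k)))
    ((hallCoeff_finite X Y).subset fun Z hZ h => hZ (by simp [h]))

/-- The bilinear multiplication that extends `hallProd`. -/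
noncomputable def mulMap :
    TwistedHall k →ₗ[QSqrt (Nat.card k)] TwistedHall k →ₗ[QSqrt (Nat.card k)] TwistedHall k :=
  Finsupp.linearCombination (QSqrt (Nat.card k)) fun X =>
    (Finsupp.linearCombination (QSqrt (Nat.card k)) (fun Y => hallProd X Y) :
      TwistedHall k →ₗ[QSqrt (Nat.card k)] TwistedHall k)

theorem mulMap_basisVec (X Y : IsoClass (Lam k)) :
    mulMap (basisVec X) (basisVec Y) = hallProd X Y := by
  unfold mulMap basisVec
  erw [Finsupp.linearCombination_single, one_smul, Finsupp.linearCombination_single, one_smul]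

theorem linearMap_ext {V : Type*} [AddCommGroup V] [Module (QSqrt (Nat.card k)) V]
    {f g : TwistedHall k →ₗ[QSqrt (Nat.card k)] V} (h : ∀ X, f (basisVec X) = g (basisVec X)) :
    f = g :=
  Finsupp.lhom_ext' fun X => LinearMap.ext_ring (h X)

/-- The structure constants of the twisted Hall algebra. -/
noncomputable def tcoeff (X Y Z : IsoClass (Lam k)) : QSqrt (Nat.card k) :=
  vv k ^ euler X.rep Y.rep * ((hallCoeff X Y Z : ℚ) : QSqrt (Nat.card k))

/-- The coordinate at a class. -/
noncomputable def coord (W : IsoClass (Lam k)) :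
    TwistedHall k →ₗ[QSqrt (Nat.card k)] QSqrt (Nat.card k) :=
  Finsupp.lapply W

theorem coord_ext {x y : TwistedHall k} (h : ∀ W, coord W x = coord W y) : x = y := Finsupp.ext h

open Classical in
theorem coord_basisVec (W X : IsoClass (Lam k)) :
    coord W (basisVec X) = if X = W then 1 else 0 := Finsupp.single_apply

theorem coord_hallProd (W X Y : IsoClass (Lam k)) : coord W (hallProd X Y) = tcoeff X Y W := rfl

theorem tcoeff_eq_zero {X Y Z : IsoClass (Lam k)} (h : hallNum X Y Z = 0) : tcoeff X Y Z = 0 := by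
  have : hallCoeff X Y Z = 0 := by
    by_contra h'
    exact (hallCoeff_ne_zero_iff X Y Z).1 h' h
  simp [tcoeff, this]

theorem hallProd_eq_sum (X Y : IsoClass (Lam k)) :
    hallProd X Y = ∑ Z ∈ (hallNum_finite X Y).toFinset, tcoeff X Y Z • basisVec Z := by
  classical
  refine coord_ext fun W => ?_
  rw [map_sum, coord_hallProd]
  simp only [map_smul, coord_basisVec, smul_eq_mul, mul_ite, mul_one, mul_zero,
    Finset.sum_ite_eq']
  split_ifs with h
  · rfl
  · exact tcoeff_eq_zero (by simpa using h)

theorem coord_mul_left (X Y Z W : IsoClass (Lam k)) :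
    coord W (mulMap (hallProd X Y) (basisVec Z)) = ∑ᶠ U, tcoeff X Y U * tcoeff U Z W := by
  rw [finsum_eq_sum_of_support_subset (s := (hallNum_finite X Y).toFinset), hallProd_eq_sum]
  · simp only [map_sum, map_smul, LinearMap.sum_apply, LinearMap.smul_apply, mulMap_basisVec,
      coord_hallProd, smul_eq_mul]
  · intro U hU
    have : tcoeff X Y U ≠ 0 := left_ne_zero_of_mul hU
    simpa using fun h => this (tcoeff_eq_zero h)

theorem coord_mul_right (X Y Z W : IsoClass (Lam k)) :
    coord W (mulMap (basisVec X) (hallProd Y Z)) = ∑ᶠ U, tcoeff X U W * tcoeff Y Z U := by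
  rw [finsum_eq_sum_of_support_subset (s := (hallNum_finite Y Z).toFinset), hallProd_eq_sum]
  · simp only [map_sum, map_smul, mulMap_basisVec, coord_hallProd, smul_eq_mul, mul_comm]
  · intro U hU
    have : tcoeff Y Z U ≠ 0 := right_ne_zero_of_mul hU
    simpa using fun h => this (tcoeff_eq_zero h)

theorem tcoeff_mul_left (X Y Z W U : IsoClass (Lam k)) :
    tcoeff X Y U * tcoeff U Z W =
      (vv k ^ (cdim X * cdim Y + cdim X * cdim Z + cdim Y * cdim Z) *
        (autNum X * autNum Y * autNum Z / autNum W)) * ((hallNum X Y U * hallNum U Z W : ℕ)) := by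
  by_cases h : hallNum X Y U = 0
  · simp [tcoeff_eq_zero h, h]
  · have hU : (autNum U : QSqrt (Nat.card k)) ≠ 0 := by exact_mod_cast autNum_ne_zero U
    have e1 : euler X.rep Y.rep = ((cdim X * cdim Y : ℕ) : ℤ) := by rw [euler_eq]; simp [cdim]
    have e2 : euler U.rep Z.rep = ((cdim U * cdim Z : ℕ) : ℤ) := by rw [euler_eq]; simp [cdim]
    rw [tcoeff, tcoeff, e1, e2, zpow_natCast, zpow_natCast, cdim_add h, hallCoeff_eq, hallCoeff_eq]
    push_cast
    field_simp
    ring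

theorem tcoeff_mul_right (X Y Z W U : IsoClass (Lam k)) :
    tcoeff X U W * tcoeff Y Z U =
      (vv k ^ (cdim X * cdim Y + cdim X * cdim Z + cdim Y * cdim Z) *
        (autNum X * autNum Y * autNum Z / autNum W)) * ((hallNum X U W * hallNum Y Z U : ℕ)) := by
  by_cases h : hallNum Y Z U = 0
  · simp [tcoeff_eq_zero h, h]
  · have hU : (autNum U : QSqrt (Nat.card k)) ≠ 0 := by exact_mod_cast autNum_ne_zero U
    have e1 : euler X.rep U.rep = ((cdim X * cdim U : ℕ) : ℤ) := by rw [euler_eq]; simp [cdim]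
    have e2 : euler Y.rep Z.rep = ((cdim Y * cdim Z : ℕ) : ℤ) := by rw [euler_eq]; simp [cdim]
    rw [tcoeff, tcoeff, e1, e2, zpow_natCast, zpow_natCast, cdim_add h, hallCoeff_eq, hallCoeff_eq]
    push_cast
    field_simp
    ring

theorem hall_induction {P : TwistedHall k → Prop} (x : TwistedHall k) (h0 : P 0)
    (hadd : ∀ x y, P x → P y → P (x + y))
    (hb : ∀ (c : QSqrt (Nat.card k)) (X : IsoClass (Lam k)), P (c • basisVec X)) : P x := by
  refine Finsupp.induction_linear (motive := P) x h0 hadd fun X c => ?_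
  have h : c • basisVec X = (Finsupp.single X c : IsoClass (Lam k) →₀ QSqrt (Nat.card k)) := by
    unfold basisVec
    erw [Finsupp.smul_single, smul_eq_mul, mul_one]
  exact h ▸ hb c X

theorem mulMap_assoc (x y z : TwistedHall k) : mulMap (mulMap x y) z = mulMap x (mulMap y z) := by
  induction x using hall_induction with
  | h0 => simp
  | hadd x x' h h' => simp [h, h']
  | hb a X =>
    induction y using hall_induction with
    | h0 => simp
    | hadd y y' h h' => simp only [map_add, LinearMap.add_apply, h, h']
    | hb b Y =>
      induction z using hall_induction with
      | h0 => simp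
      | hadd z z' h h' => simp only [map_add, h, h']
      | hb c Z =>
        simp only [map_smul, LinearMap.smul_apply]
        congr 3
        rw [mulMap_basisVec, mulMap_basisVec]
        refine coord_ext fun W => ?_
        rw [coord_mul_left, coord_mul_right]
        simp only [tcoeff_mul_left, tcoeff_mul_right]
        have fin1 : (Function.support fun U => hallNum X Y U * hallNum U Z W).Finite :=
          (hallNum_finite X Y).subset fun U hU => left_ne_zero_of_mul hU
        have fin2 : (Function.support fun U => hallNum X U W * hallNum Y Z U).Finite :=
          (hallNum_finite Y Z).subset fun U hU => right_ne_zero_of_mul hU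
        rw [← mul_finsum, ← mul_finsum]
        congr 1
        have h := congrArg (Nat.cast : ℕ → QSqrt (Nat.card k)) (hallNum_assoc X Y Z W)
        rw [finsum_eq_sum _ fin1, finsum_eq_sum _ fin2] at h
        rw [finsum_eq_sum_of_support_subset (s := fin1.toFinset),
          finsum_eq_sum_of_support_subset (s := fin2.toFinset)]
        · exact_mod_cast h
        · intro U; simp
        · intro U; simp

/-- The class of the zero module. -/
def zeroClass (A : Type u) [Ring A] : IsoClass A := IsoClass.mk A PUnit

instance (A : Type u) [Ring A] [Finite A] : Subsingleton (zeroClass A).rep := by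
  obtain ⟨e⟩ := IsoClass.rep_mk (A := A) PUnit
  exact e.toEquiv.subsingleton

theorem autNum_zeroClass : autNum (zeroClass (Lam k)) = 1 := by
  have : Unique ((zeroClass (Lam k)).rep ≃ₗ[Lam k] (zeroClass (Lam k)).rep) :=
    ⟨⟨LinearEquiv.refl _ _⟩, fun e => by ext x; exact Subsingleton.elim _ _⟩
  exact Nat.card_unique

theorem euler_zero_left (Y : IsoClass (Lam k)) : euler (zeroClass (Lam k)).rep Y.rep = 0 := by
  have : Subsingleton (res (zeroClass (Lam k)).rep) :=
    inferInstanceAs (Subsingleton (zeroClass (Lam k)).rep)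
  rw [euler_eq, Module.finrank_zero_of_subsingleton (M := res (zeroClass (Lam k)).rep)]
  simp

theorem euler_zero_right (Y : IsoClass (Lam k)) : euler Y.rep (zeroClass (Lam k)).rep = 0 := by
  have : Subsingleton (res (zeroClass (Lam k)).rep) :=
    inferInstanceAs (Subsingleton (zeroClass (Lam k)).rep)
  rw [euler_eq, Module.finrank_zero_of_subsingleton (M := res (zeroClass (Lam k)).rep)]
  simp

open Classical in
theorem hallNum_zero_left (Y W : IsoClass (Lam k)) :
    hallNum (zeroClass (Lam k)) Y W = if Y = W then 1 else 0 := by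
  have key (X : Submodule (Lam k) W.rep)
      (hX : X ∈ hallSub (Lam k) (zeroClass (Lam k)).rep Y.rep W.rep) : X = ⊤ := by
    obtain ⟨-, ⟨e⟩⟩ := hX
    have := e.toEquiv.subsingleton
    exact Submodule.Quotient.subsingleton_iff.1 this
  split_ifs with h
  · subst h
    have : Unique (hallSub (Lam k) (zeroClass (Lam k)).rep Y.rep Y.rep) :=
      ⟨⟨⟨⊤, ⟨Submodule.topEquiv⟩, ⟨by
        have : Subsingleton (Y.rep ⧸ (⊤ : Submodule (Lam k) Y.rep)) :=
          Submodule.Quotient.subsingleton_iff.2 rfl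
        exact
          { toFun := 0, invFun := 0, map_add' := by simp, map_smul' := by simp,
            left_inv := fun _ => Subsingleton.elim _ _,
            right_inv := fun _ => Subsingleton.elim _ _ }⟩⟩⟩,
        fun X => Subtype.ext (key X.1 X.2)⟩
    exact Nat.card_unique
  · have : IsEmpty (hallSub (Lam k) (zeroClass (Lam k)).rep Y.rep W.rep) := by
      refine ⟨fun X => h ?_⟩
      obtain ⟨X, hX⟩ := X
      have := key X hX
      subst this
      rw [← IsoClass.mk_rep W, IsoClass.eq_mk_iff]
      exact ⟨hX.1.some.symm.trans Submodule.topEquiv⟩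
    exact Nat.card_of_isEmpty

open Classical in
theorem hallNum_zero_right (X W : IsoClass (Lam k)) :
    hallNum X (zeroClass (Lam k)) W = if X = W then 1 else 0 := by
  have key (V : Submodule (Lam k) W.rep)
      (hV : V ∈ hallSub (Lam k) X.rep (zeroClass (Lam k)).rep W.rep) : V = ⊥ := by
    obtain ⟨⟨e⟩, -⟩ := hV
    have := e.toEquiv.subsingleton
    exact Submodule.eq_bot_of_subsingleton
  split_ifs with h
  · subst h
    have : Unique (hallSub (Lam k) X.rep (zeroClass (Lam k)).rep X.rep) :=
      ⟨⟨⟨⊥, ⟨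
          { toFun := 0, invFun := 0, map_add' := by simp, map_smul' := by simp,
            left_inv := fun _ => Subsingleton.elim _ _,
            right_inv := fun _ => Subsingleton.elim _ _ }⟩,
          ⟨Submodule.quotEquivOfEqBot ⊥ rfl⟩⟩⟩,
        fun V => Subtype.ext (key V.1 V.2)⟩
    exact Nat.card_unique
  · have : IsEmpty (hallSub (Lam k) X.rep (zeroClass (Lam k)).rep W.rep) := by
      refine ⟨fun V => h ?_⟩
      obtain ⟨V, hV⟩ := V
      have := key V hV
      subst this
      rw [← IsoClass.mk_rep W, IsoClass.eq_mk_iff]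
      exact ⟨hV.2.some.symm.trans (Submodule.quotEquivOfEqBot ⊥ rfl)⟩
    exact Nat.card_of_isEmpty

theorem hallProd_zero_left (Y : IsoClass (Lam k)) :
    hallProd (zeroClass (Lam k)) Y = basisVec Y := by
  refine coord_ext fun W => ?_
  rw [coord_hallProd, coord_basisVec, tcoeff, euler_zero_left, hallCoeff_eq, hallNum_zero_left,
    autNum_zeroClass]
  split_ifs with h
  · subst h
    have h : autNum Y ≠ 0 := by exact_mod_cast autNum_ne_zero Y
    simp [h]
  · simp

theorem hallProd_zero_right (X : IsoClass (Lam k)) :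
    hallProd X (zeroClass (Lam k)) = basisVec X := by
  refine coord_ext fun W => ?_
  rw [coord_hallProd, coord_basisVec, tcoeff, euler_zero_right, hallCoeff_eq, hallNum_zero_right,
    autNum_zeroClass]
  split_ifs with h
  · subst h
    have h : autNum X ≠ 0 := by exact_mod_cast autNum_ne_zero X
    simp [h]
  · simp

noncomputable instance : Ring (TwistedHall k) :=
  { (inferInstance : AddCommGroup (TwistedHall k)) with
    mul := fun x y => mulMap x y
    one := basisVec (zeroClass (Lam k))
    left_distrib := fun x y z => map_add (mulMap x) y z
    right_distrib := fun x y z => by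
      change mulMap (x + y) z = mulMap x z + mulMap y z
      rw [map_add, LinearMap.add_apply]
    zero_mul := fun x => by
      change mulMap 0 x = 0
      rw [map_zero, LinearMap.zero_apply]
    mul_zero := fun x => map_zero (mulMap x)
    mul_assoc := mulMap_assoc
    one_mul := fun x => by
      change mulMap (basisVec (zeroClass (Lam k))) x = x
      induction x using hall_induction with
      | h0 => simp
      | hadd x x' h h' => rw [map_add, h, h']
      | hb a X => rw [map_smul, mulMap_basisVec, hallProd_zero_left]
    mul_one := fun x => by
      change mulMap x (basisVec (zeroClass (Lam k))) = x
      induction x using hall_induction with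
      | h0 => simp
      | hadd x x' h h' => rw [map_add, LinearMap.add_apply, h, h']
      | hb a X => rw [map_smul, LinearMap.smul_apply, mulMap_basisVec, hallProd_zero_right] }

noncomputable instance : Algebra (QSqrt (Nat.card k)) (TwistedHall k) :=
  Algebra.ofModule
    (fun r x y => by
      change mulMap (r • x) y = r • mulMap x y
      rw [map_smul, LinearMap.smul_apply])
    (fun r x y => map_smul (mulMap x) r y)

end Twisted

/-! ### Grothendieck group, singularity category, localization -/

section Semiderived

/-- The relations `L = M + N` for the short exact sequences `0 ⟶ N ⟶ L ⟶ M ⟶ 0`. -/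
def k0Relations (A : Type u) [Ring A] [Finite A] : AddSubgroup (FreeAbelianGroup (IsoClass A)) :=
  AddSubgroup.closure {x | ∃ M N L : FGModuleCat.{u} A, Nonempty (Confl M N L) ∧
    x = FreeAbelianGroup.of (IsoClass.mk A L) - FreeAbelianGroup.of (IsoClass.mk A M) -
      FreeAbelianGroup.of (IsoClass.mk A N)}

/-- The Grothendieck group `K₀(mod A)`. -/
abbrev K0 (A : Type u) [Ring A] [Finite A] : Type (u + 1) :=
  FreeAbelianGroup (IsoClass A) ⧸ k0Relations A

/-- The class of a module in `K₀(mod A)`. -/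
def K0.cls {A : Type u} [Ring A] [Finite A] (M : FGModuleCat.{u} A) : K0 A :=
  QuotientAddGroup.mk (FreeAbelianGroup.of (IsoClass.mk A M))

section Singularity

variable (C : Type u) [Category.{v} C] [Abelian C] [HasDerivedCategory.{w} C]

/-- The bounded derived category `𝒟ᵇ(C)`. -/
abbrev BoundedDerived : Type _ := (DerivedCategory.TStructure.t (C := C)).bounded.FullSubcategory

variable {C} in
/-- An object of `C`, seen as a complex in degree `0`. -/
noncomputable def BoundedDerived.single (M : C) : BoundedDerived C :=
  ⟨(DerivedCategory.singleFunctor C 0).obj M, ⟨0, inferInstance⟩, ⟨0, inferInstance⟩⟩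

/-- The complexes in `𝒟ᵇ(C)` that are isomorphic to an object of `C` of finite projective
dimension. -/
def finProjDim : ObjectProperty (BoundedDerived C) := fun X =>
  ∃ (M : C) (n : ℕ), HasProjectiveDimensionLE M n ∧ Nonempty (X ≅ BoundedDerived.single M)

/-- The singularity category: the Verdier quotient of `𝒟ᵇ(C)` by the thick subcategory that is
generated by the objects of finite projective dimension. -/
abbrev SingularityCategory : Type _ := (finProjDim C).triangEnvelope.trW.Localization

variable {C} in
/-- The image of an object of `C` in the singularity category. -/
noncomputable def SingularityCategory.of (M : C) : SingularityCategory C :=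
  (finProjDim C).triangEnvelope.trW.Q.obj (BoundedDerived.single M)

end Singularity

/-- `M` and `N` are isomorphic in the singularity category. -/
def SingIso {C : Type u} [Category.{v} C] [Abelian C] (M N : C) : Prop :=
  letI := HasDerivedCategory.standard C
  Nonempty (SingularityCategory.of M ≅ SingularityCategory.of N)

/-- The relations that define the universal localization of the `F`-algebra `R` at the set `S`:
the elements of `R` are added, multiplied and scaled as in `R`, and `Sum.inr s` is a two-sided
inverse of `Sum.inl s`, for `s ∈ S`. -/
inductive LocRel (F : Type*) [CommRing F] {R : Type*} [Ring R] [Algebra F R] (S : Set R) :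
    FreeAlgebra F (R ⊕ S) → FreeAlgebra F (R ⊕ S) → Prop
  | add (a b : R) : LocRel F S (FreeAlgebra.ι F (Sum.inl (a + b)))
      (FreeAlgebra.ι F (Sum.inl a) + FreeAlgebra.ι F (Sum.inl b))
  | mul (a b : R) : LocRel F S (FreeAlgebra.ι F (Sum.inl (a * b)))
      (FreeAlgebra.ι F (Sum.inl a) * FreeAlgebra.ι F (Sum.inl b))
  | algebraMap (c : F) : LocRel F S (FreeAlgebra.ι F (Sum.inl (algebraMap F R c)))
      (algebraMap F (FreeAlgebra F (R ⊕ S)) c)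
  | inv_mul (s : S) : LocRel F S
      (FreeAlgebra.ι F (Sum.inr s) * FreeAlgebra.ι F (Sum.inl s.1)) 1
  | mul_inv (s : S) : LocRel F S
      (FreeAlgebra.ι F (Sum.inl s.1) * FreeAlgebra.ι F (Sum.inr s)) 1

/-- The localization `R[S⁻¹]`: the universal `F`-algebra under `R` in which the elements of `S`
are invertible. If `S` satisfies the Ore conditions, it is the Ore localization. -/
abbrev UnivLoc (F : Type*) [CommRing F] {R : Type*} [Ring R] [Algebra F R] (S : Set R) : Type _ :=
  RingQuot (LocRel F S)

/-- The canonical map `R → R[S⁻¹]`. -/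
def UnivLoc.of (F : Type*) [CommRing F] {R : Type*} [Ring R] [Algebra F R] (S : Set R) :
    R →ₐ[F] UnivLoc F S where
  toFun a := RingQuot.mkAlgHom F (LocRel F S) (FreeAlgebra.ι F (Sum.inl a))
  map_one' := by
    have h := RingQuot.mkAlgHom_rel F (LocRel.algebraMap (F := F) (S := S) 1)
    simpa using h
  map_zero' := by
    have h := RingQuot.mkAlgHom_rel F (LocRel.algebraMap (F := F) (S := S) 0)
    simpa using h
  map_mul' a b := by
    simpa using RingQuot.mkAlgHom_rel F (LocRel.mul (F := F) (S := S) a b)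
  map_add' a b := by
    simpa using RingQuot.mkAlgHom_rel F (LocRel.add (F := F) (S := S) a b)
  commutes' c := by
    have h := RingQuot.mkAlgHom_rel F (LocRel.algebraMap (F := F) (S := S) c)
    rwa [AlgHom.commutes] at h

end Semiderived

/-! ### The `ı`Hall algebra of the `ı`quiver with one vertex and trivial involution -/

section IHallAlgebra

variable (k : Type u) [Field k] [Finite k]

/-- The generators `[M] - [N]` of the ideal `I`. -/
inductive IdealRel : TwistedHall k → TwistedHall k → Prop
  | mk (M N : FGModuleCat.{u} (Lam k)) (h₀ : K0.cls M = K0.cls N) (h₁ : SingIso M N) :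
      IdealRel (basisVec (IsoClass.mk (Lam k) M)) (basisVec (IsoClass.mk (Lam k) N))

/-- The quotient of the twisted Hall algebra by the two-sided ideal `I`. -/
abbrev HallQuot : Type (u + 1) := RingQuot (IdealRel k)

/-- The elements `a[K]` with `a ∈ ℚ` nonzero and `K` of projective dimension at most `1`. -/
def denominators : Set (HallQuot k) :=
  {x | ∃ (a : ℚ) (K : FGModuleCat.{u} (Lam k)), a ≠ 0 ∧ HasProjectiveDimensionLE K 1 ∧
    x = (a : QSqrt (Nat.card k)) •
      RingQuot.mkAlgHom (QSqrt (Nat.card k)) (IdealRel k) (basisVec (IsoClass.mk (Lam k) K))}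

/-- The `ı`Hall algebra of the `ı`quiver with one vertex, no arrow and trivial involution: the
twisted semi-derived Ringel-Hall algebra of `𝐤[x]/(x²)`. -/
abbrev IHallAlgebra : Type (u + 1) := UnivLoc (QSqrt (Nat.card k)) (denominators k)

/-- The class `[M]` of a finite-dimensional `𝐤[x]/(x²)`-module. -/
noncomputable def hallClass (M : Type u) [AddCommGroup M] [Module (Lam k) M]
    [Module.Finite (Lam k) M] : IHallAlgebra k :=
  UnivLoc.of (QSqrt (Nat.card k)) (denominators k)
    (RingQuot.mkAlgHom (QSqrt (Nat.card k)) (IdealRel k) (basisVec (IsoClass.mk (Lam k) M)))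

/-- The simple module `S`, one-dimensional over `𝐤` with `x` acting by zero. -/
abbrev SimpleMod : Type u := Lam k ⧸ Ideal.span {(DualNumber.eps : Lam k)}

/-- `[S]`. -/
noncomputable def clsS : IHallAlgebra k := hallClass k (SimpleMod k)

/-- `[mS]`, the class of the direct sum of `m` copies of `S`. -/
noncomputable def clsNS (m : ℕ) : IHallAlgebra k := hallClass k (Fin m → SimpleMod k)

/-- `[𝕂]`, the class of the module `𝕂 = 𝐤[x]/(x²)`. -/
noncomputable def clsK : IHallAlgebra k := hallClass k (Lam k)

/-- The quantum integer `[r] = (𝐯^r - 𝐯^{-r}) / (𝐯 - 𝐯⁻¹)`. -/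
noncomputable def qInt (r : ℤ) : QSqrt (Nat.card k) :=
  (vv k ^ r - vv k ^ (-r)) / (vv k - (vv k)⁻¹)

/-- The quantum factorial `[m]! = [1][2]⋯[m]`. -/
noncomputable def qFact (m : ℕ) : QSqrt (Nat.card k) := ∏ i ∈ Finset.Icc 1 m, qInt k i

/-- The quantum double factorial `[2m]!! = [2][4]⋯[2m]`. -/
noncomputable def qDoubleFact (m : ℕ) : QSqrt (Nat.card k) := ∏ i ∈ Finset.Icc 1 m, qInt k (2 * i)

/-- The factor `[S]² + 𝐯⁻¹(𝐯² - 1)²[r]²[𝕂]`. -/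
noncomputable def idpFactor (r : ℤ) : IHallAlgebra k :=
  clsS k ^ 2 + ((vv k)⁻¹ * (vv k ^ 2 - 1) ^ 2 * qInt k r ^ 2) • clsK k

/-- The `ı`divided power `[S]^{(m)}` of odd parity `1̄`; the `j`-th factor is the one with
`[2(j+1)-1]²`, for `0 ≤ j < ⌊m/2⌋`. -/
noncomputable def idpOdd (m : ℕ) : IHallAlgebra k :=
  (qFact k m)⁻¹ •
    if Odd m then clsS k * ((List.range (m / 2)).map fun j => idpFactor k (2 * (j + 1) - 1)).prod
    else ((List.range (m / 2)).map fun j => idpFactor k (2 * (j + 1) - 1)).prod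

/-- The `ı`divided power `[S]^{(m)}` of even parity `0̄`; the `j`-th factor is the one with
`[2(j+1)]²` if `m` is odd and with `[2(j+1)-2]²` if `m` is even, for `0 ≤ j < ⌊m/2⌋`. -/
noncomputable def idpEven (m : ℕ) : IHallAlgebra k :=
  (qFact k m)⁻¹ •
    if Odd m then clsS k * ((List.range (m / 2)).map fun j => idpFactor k (2 * (j + 1))).prod
    else ((List.range (m / 2)).map fun j => idpFactor k (2 * (j + 1) - 2)).prod

end IHallAlgebra

end IHall

/-! Everything follows from one product in the twisted Hall algebra. For `m ≥ 1` the group `Ext¹(S,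
mS)` has `q^m` elements: the zero class has middle term `(m+1)S`, and each nonzero class has middle
term `𝕂 ⊕ (m-1)S`. The Euler twist `𝐯^m` and the factor `1/|Hom| = 𝐯^{-2m}` then give `[S] * [mS] =
𝐯^{-m} [(m+1)S] + (𝐯^m - 𝐯^{-m}) [(m-1)S] * [𝕂]`, which is `clsS_mul_clsNS`. Since `𝕂` is both
projective and injective, the products `[𝕂] * [M]` and `[S] * [𝕂]` involve split extensions only,
and `[𝕂]` commutes with every `[mS]`. These relations are proved in the twisted Hall algebra and
carried over by the canonical maps to the quotient and to the localization.

Let `E_σ(n)` be the claimed sum with power `𝐯^{i(i-σ)}` in its coefficients (`idpExpansion`). The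
theorem says that the `ı`divided power is `E_1(n)` if its parity is that of `n`, and `E_{-1}(n)`
otherwise. The product formula yields two recursions: `[n+1] E_1(n+1) = [S] E_{-1}(n)` and `[n+2]
E_{-1}(n+2) = [S] E_1(n+1) + 𝐯⁻¹(𝐯²-1)²[n+1] [𝕂] E_{-1}(n)`. Coefficient by coefficient they reduce
to the addition formulas `qInt_add` and `qInt_add'` for quantum integers.

Put `X_n = [n]! E_{-1}(n)`. The recursions become `[n+1]! E_1(n+1) = [S] X_n` and `X_{n+2} = ([S]² +
𝐯⁻¹(𝐯²-1)²[n+1]²[𝕂]) X_n`. Starting from `X_0 = 1` and `X_1 = [S]`, they produce exactly the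
products that define the `ı`divided powers. -/

namespace IHall

/-! ### Extension classes in an abelian category: pushouts, splitting, dimension shifting -/

section AbelianExt

variable {C : Type u} [Category.{v} C] [Abelian C]

namespace Confl

/-- The pushout of a short exact sequence along a morphism out of its left term. -/
theorem exists_pushout {M N L N' : C} (c : Confl M N L) (f : N ⟶ N') :
    ∃ (L' : C) (d : Confl M N' L') (g : L ⟶ L'), c.i ≫ g = f ≫ d.i ∧ g ≫ d.p = c.p := by
  have : Mono c.i := c.exact.mono_f
  have : Epi c.p := c.exact.epi_g
  have sq := IsPushout.of_hasPushout c.i f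
  let p := Limits.pushout.desc (f := c.i) (g := f) c.p 0 (by rw [c.zero, Limits.comp_zero])
  have h₁ : Limits.pushout.inl c.i f ≫ p = c.p := Limits.pushout.inl_desc _ _ _
  have h₂ : Limits.pushout.inr c.i f ≫ p = 0 := Limits.pushout.inr_desc _ _ _
  have : Epi p := by
    have : Epi (Limits.pushout.inl c.i f ≫ p) := by rw [h₁]; infer_instance
    exact epi_of_epi (Limits.pushout.inl c.i f) p
  have hm : Mono (Limits.pushout.inr c.i f) := inferInstance
  refine ⟨_, ⟨Limits.pushout.inr c.i f, p, h₂, ?_⟩, Limits.pushout.inl c.i f, sq.w, h₁⟩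
  refine { exact := ?_, mono_f := hm, epi_g := this }
  -- Exactness is checked on generalized elements. An `x` killed by `p` is locally `y + z` with `y`
  -- in `L` and `z` in `N'`. Then `y` is killed by `c.p`, so it comes from some `w` in `N`, and the
  -- pushout square moves `w` into `N'`.
  rw [ShortComplex.exact_iff_exact_up_to_refinements]
  intro T x hx
  obtain ⟨T', π, _, y, z, hyz⟩ := sq.hom_eq_add_up_to_refinements x
  have hy : y ≫ c.p = 0 := by
    have : (π ≫ x) ≫ p = 0 := by
      rw [Category.assoc]
      exact (congrArg (π ≫ ·) hx).trans Limits.comp_zero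
    rwa [hyz, Preadditive.add_comp, Category.assoc, Category.assoc, h₁, h₂, Limits.comp_zero,
      add_zero] at this
  obtain ⟨T'', π', _, w, hw⟩ := c.exact.exact.exact_up_to_refinements y hy
  refine ⟨T'', π' ≫ π, inferInstance, w ≫ f + π' ≫ z, ?_⟩
  change (π' ≫ π) ≫ x = (w ≫ f + π' ≫ z) ≫ Limits.pushout.inr c.i f
  have hw' : π' ≫ y = w ≫ c.i := hw
  rw [Category.assoc, hyz, Preadditive.comp_add, Preadditive.add_comp, ← Category.assoc, hw',
    Category.assoc, sq.w]
  simp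

variable [HasExt.{w} C]

/-- The connecting map `Hom(N, N) → Ext¹(M, N)` sends the identity to the class. By exactness the
class vanishes precisely when the identity of `N` extends along `i`. -/
theorem cls_eq_zero_iff {M N L : C} (c : Confl M N L) : c.cls = 0 ↔ ∃ r : L ⟶ N, c.i ≫ r = 𝟙 N := by
  constructor
  · intro h
    obtain ⟨x, hx⟩ := Abelian.Ext.contravariant_sequence_exact₁ c.exact N
      (Abelian.Ext.mk₀ (𝟙 N)) (n₁ := 1) rfl (by
        have h' : c.exact.extClass = 0 := h
        rw [h', Abelian.Ext.zero_comp])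
    obtain ⟨r, rfl⟩ := Abelian.Ext.addEquiv₀.symm.surjective x
    refine ⟨r, (Abelian.Ext.mk₀_bijective _ _).1 ?_⟩
    simpa using hx
  · rintro ⟨r, hr⟩
    have h := c.exact.extClass_comp_assoc (Abelian.Ext.mk₀ r) (h := add_zero 1)
    rw [Abelian.Ext.mk₀_comp_mk₀] at h
    change c.exact.extClass.comp (Abelian.Ext.mk₀ (c.i ≫ r)) _ = 0 at h
    rwa [hr, Abelian.Ext.comp_mk₀_id] at h

theorem exists_cls_eq_comp {M N L N' : C} (c : Confl M N L) (f : N ⟶ N') :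
    ∃ (L' : C) (d : Confl M N' L'), d.cls = c.cls.comp (Abelian.Ext.mk₀ f) (add_zero 1) := by
  obtain ⟨L', d, g, h₁, h₂⟩ := c.exists_pushout f
  have h := ShortComplex.ShortExact.extClass_naturality c.exact d.exact
    (ShortComplex.homMk f g (𝟙 M) h₁.symm (by
      change g ≫ d.p = c.p ≫ 𝟙 M
      rw [h₂, Category.comp_id]))
  simp only [ShortComplex.homMk_τ₁, ShortComplex.homMk_τ₃, Abelian.Ext.mk₀_id_comp] at h
  exact ⟨L', d, h.symm⟩

variable {M N L : C} [Projective L] (N' : C)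

/-- Dimension shifting: `Ext¹(L, N')` vanishes because `L` is projective, so the connecting map is
onto. -/
theorem exists_eq_cls_comp (c : Confl M N L) (e : Abelian.Ext M N' 1) :
    ∃ f : N ⟶ N', c.cls.comp (Abelian.Ext.mk₀ f) (add_zero 1) = e := by
  obtain ⟨x, hx⟩ := Abelian.Ext.contravariant_sequence_exact₃ c.exact N' e
    (Abelian.Ext.eq_zero_of_projective _) (n₀ := 0) rfl
  obtain ⟨f, rfl⟩ := Abelian.Ext.addEquiv₀.symm.surjective x
  exact ⟨f, hx⟩

/-- Every class is the class of a short exact sequence. -/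
theorem exists_cls_eq (c : Confl M N L) (e : Abelian.Ext M N' 1) : ∃ (L' : C) (d : Confl M N' L'), d.cls = e := by
  obtain ⟨f, rfl⟩ := c.exists_eq_cls_comp N' e
  exact c.exists_cls_eq_comp f

/-- If every `L ⟶ N'` vanishes on `N`, then `Ext¹(M, N')` is a copy of `Hom(N, N')`. -/
theorem card_ext_eq (c : Confl M N L) (h : ∀ g : L ⟶ N', c.i ≫ g = 0) :
    Nat.card (Abelian.Ext M N' 1) = Nat.card (N ⟶ N') := by
  symm
  refine Nat.card_congr (Equiv.ofBijective
    (fun f => c.cls.comp (Abelian.Ext.mk₀ f) (add_zero 1)) ⟨fun f f' hf => ?_,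
    c.exists_eq_cls_comp N'⟩)
  -- The difference lies in the kernel of the connecting map, hence is the restriction to `N` of
  -- some `g : L ⟶ N'`, and `h` makes this restriction zero.
  have h0 : c.cls.comp (Abelian.Ext.mk₀ (f - f')) (add_zero 1) = 0 := by
    rw [sub_eq_add_neg, Abelian.Ext.mk₀_add, Abelian.Ext.mk₀_neg, Abelian.Ext.comp_add,
      Abelian.Ext.comp_neg, ← sub_eq_add_neg, sub_eq_zero]
    exact hf
  obtain ⟨x, hx⟩ := Abelian.Ext.contravariant_sequence_exact₁ c.exact N'
    (Abelian.Ext.mk₀ (f - f')) (n₁ := 1) rfl h0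
  obtain ⟨g, rfl⟩ := Abelian.Ext.addEquiv₀.symm.surjective x
  have hg : c.i ≫ g = f - f' := by
    apply (Abelian.Ext.mk₀_bijective _ _).1
    simpa using hx
  rw [h] at hg
  exact sub_eq_zero.1 hg.symm

end Confl

/-- The middle term may be replaced by an isomorphic object. The comparison of sequences is the
identity on both ends, so the class does not change. -/
theorem extMid_of_iso [HasExt.{w} C] {M N L L' : C} (c : Confl M N L) (e : L ≅ L') :
    c.cls ∈ extMid M N L' := by
  have z : (c.i ≫ e.hom) ≫ e.inv ≫ c.p = 0 := by simp [c.zero]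
  let E : ShortComplex.mk c.i c.p c.zero ≅ ShortComplex.mk _ _ z :=
    ShortComplex.isoMk (Iso.refl N) e (Iso.refl M) (by simp) (by simp)
  have hE := ShortComplex.shortExact_of_iso E c.exact
  refine ⟨_, _, z, hE, ?_⟩
  have h := ShortComplex.ShortExact.extClass_naturality c.exact hE E.hom
  change c.exact.extClass.comp (Abelian.Ext.mk₀ (𝟙 N)) _ = (Abelian.Ext.mk₀ (𝟙 M)).comp _ _ at h
  rw [Abelian.Ext.comp_mk₀_id, Abelian.Ext.mk₀_id_comp] at h
  exact h.symm

end AbelianExt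

/-! ### Split extensions of finite modules -/

section ModuleExt

variable {A : Type u} [Ring A] [Finite A]

theorem Confl.exists_retraction_iff {M N L : FGModuleCat.{u} A} (c : Confl M N L) :
    (∃ r : L ⟶ N, c.i ≫ r = 𝟙 N) ↔ ∃ r : L →ₗ[A] N, r ∘ₗ c.i.hom.hom = LinearMap.id := by
  constructor
  · rintro ⟨r, hr⟩
    exact ⟨r.hom.hom, congrArg (fun f => f.hom.hom) hr⟩
  · rintro ⟨r, hr⟩
    exact ⟨FGModuleCat.ofHom r, FGModuleCat.hom_ext hr⟩

theorem Confl.nonempty_equiv_prod {M N L : FGModuleCat.{u} A} (c : Confl M N L)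
    (h : ∃ r : L →ₗ[A] N, r ∘ₗ c.i.hom.hom = LinearMap.id) : Nonempty (L ≃ₗ[A] M × N) := by
  obtain ⟨r, hr⟩ := h
  obtain ⟨_, h₂, h₃⟩ := (shortExact_iff c.i c.p c.zero).1 c.exact
  exact ⟨(lequivProdOfLeftSplitExact h₃ h₂ hr).symm.trans (LinearEquiv.prodComm A N M)⟩

theorem zero_mem_extMid_iff {M N L : FGModuleCat.{u} A} :
    (0 : Abelian.Ext M N 1) ∈ extMid M N L ↔ Nonempty (L ≃ₗ[A] M × N) := by
  constructor
  · rintro ⟨f, g, z, h, he⟩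
    let c : Confl M N L := ⟨f, g, z, h⟩
    exact c.nonempty_equiv_prod (c.exists_retraction_iff.1 (c.cls_eq_zero_iff.1 he))
  · rintro ⟨e⟩
    have z : FGModuleCat.ofHom (LinearMap.inr A M N) ≫ FGModuleCat.ofHom (LinearMap.fst A M N)
      = 0 := by ext; rfl
    let c : Confl M N (FGModuleCat.of A (M × N)) := ⟨_, _, z, by
      rw [shortExact_iff]
      exact ⟨LinearMap.inr_injective, LinearMap.range_inr A M N, LinearMap.fst_surjective⟩⟩
    have h0 : c.cls = 0 := c.cls_eq_zero_iff.2 (c.exists_retraction_iff.2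
      ⟨LinearMap.snd A M N, LinearMap.snd_comp_inr A M N⟩)
    rw [← h0]
    exact extMid_of_iso c e.symm.toFGModuleCatIso

open Classical in
/-- If all extensions split then the direct sum is the only middle term. -/
theorem card_extMid_of_split {M N : FGModuleCat.{u} A} (L : FGModuleCat.{u} A)
    (h : ∀ c : Confl M N L, ∃ r : L →ₗ[A] N, r ∘ₗ c.i.hom.hom = LinearMap.id) :
    Nat.card (extMid M N L) = if Nonempty (L ≃ₗ[A] M × N) then 1 else 0 := by
  have h0 : extMid M N L ⊆ {0} := by
    rintro _ ⟨f, g, z, hs, rfl⟩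
    let c : Confl M N L := ⟨f, g, z, hs⟩
    exact c.cls_eq_zero_iff.2 (c.exists_retraction_iff.2 (h c))
  split_ifs with hL
  · rw [(Set.Subset.antisymm h0 (Set.singleton_subset_iff.2 (zero_mem_extMid_iff.2 hL)))]
    simp
  · rcases Set.subset_singleton_iff_eq.1 h0 with h1 | h1
    · rw [h1]; simp
    · exact absurd (zero_mem_extMid_iff.1 (h1 ▸ Set.mem_singleton _)) hL

theorem fgModuleCat_projective (P : FGModuleCat.{u} A) [Module.Projective A P] : Projective P where
  factors {E X} f e _ := by
    have he : Function.Surjective e.hom.hom := by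
      have : Epi ((forget₂ (FGModuleCat.{u} A) (ModuleCat.{u} A)).map e) := inferInstance
      exact (ModuleCat.epi_iff_surjective _).1 this
    obtain ⟨g, hg⟩ := Module.projective_lifting_property e.hom.hom f.hom.hom he
    exact ⟨FGModuleCat.ofHom g, FGModuleCat.hom_ext hg⟩

end ModuleExt

end IHall

namespace IHall

open DualNumber

/-! ### Modules over the dual numbers: semisimple modules, self-injectivity, middle terms -/

section LamModules

variable {k : Type u} [Field k]

theorem lam_smul_eq {M : Type*} [AddCommGroup M] [Module (Lam k) M] (a : Lam k) (m : M) :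
    a • m = algebraMap k (Lam k) a.fst • m + algebraMap k (Lam k) a.snd • (ε : Lam k) • m := by
  rw [smul_smul, ← add_smul]
  congr 1
  ext <;> simp [TrivSqZeroExt.algebraMap_eq_inl]

/-- A module over `𝐤[x]/(x²)` on which `x` acts by zero. -/
def EpsZero (k : Type u) [Field k] (M : Type*) [AddCommGroup M] [Module (Lam k) M] : Prop :=
  ∀ m : M, (ε : Lam k) • m = 0

variable {M N L : Type u} [AddCommGroup M] [Module (Lam k) M] [AddCommGroup N] [Module (Lam k) N]
  [AddCommGroup L] [Module (Lam k) L]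

theorem EpsZero.smul_eq (hM : EpsZero k M) (a : Lam k) (m : M) :
    a • m = algebraMap k (Lam k) a.fst • m := by
  rw [lam_smul_eq, hM, smul_zero, add_zero]

theorem EpsZero.of_injective (hM : EpsZero k M) (f : L →ₗ[Lam k] M) (hf : Function.Injective f) :
    EpsZero k L := fun l => hf (by rw [map_smul, hM, map_zero])

theorem EpsZero.prod (hM : EpsZero k M) (hN : EpsZero k N) : EpsZero k (M × N) :=
  fun _ => Prod.ext (hM _) (hN _)

theorem EpsZero.pi (hM : EpsZero k M) (n : ℕ) : EpsZero k (Fin n → M) :=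
  fun _ => funext fun _ => hM _

/-- A `𝐤`-linear map between modules on which `x` acts by zero is `𝐤[x]/(x²)`-linear. -/
def EpsZero.extend [Module k M] [IsScalarTower k (Lam k) M] [Module k N]
    [IsScalarTower k (Lam k) N] (hM : EpsZero k M) (hN : EpsZero k N) (f : M →ₗ[k] N) :
    M →ₗ[Lam k] N where
  toFun := f
  map_add' := map_add f
  map_smul' a m := by
    rw [hM.smul_eq, RingHom.id_apply, hN.smul_eq, algebraMap_smul, map_smul, algebraMap_smul]

/-- Modules killed by `x` are just `𝐤`-vector spaces, where every injection splits. -/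
theorem EpsZero.exists_retraction (hN : EpsZero k N) (hL : EpsZero k L) (i : N →ₗ[Lam k] L)
    (hi : Function.Injective i) : ∃ r : L →ₗ[Lam k] N, r ∘ₗ i = LinearMap.id := by
  let : Module k N := .compHom N (algebraMap k (Lam k))
  let : Module k L := .compHom L (algebraMap k (Lam k))
  have : IsScalarTower k (Lam k) N := IsScalarTower.of_compHom k (Lam k) N
  have : IsScalarTower k (Lam k) L := IsScalarTower.of_compHom k (Lam k) L
  obtain ⟨r, hr⟩ := (i.restrictScalars k).exists_leftInverse_of_injective
    (LinearMap.ker_eq_bot.2 hi)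
  exact ⟨hL.extend hN r, LinearMap.ext fun x => LinearMap.congr_fun hr x⟩

/-- `𝐤[x]/(x²)` is self-injective. -/
theorem lam_exists_retraction (i : Lam k →ₗ[Lam k] L) (hi : Function.Injective i) :
    ∃ r : L →ₗ[Lam k] Lam k, r ∘ₗ i = LinearMap.id := by
  let : Module k L := .compHom L (algebraMap k (Lam k))
  have : IsScalarTower k (Lam k) L := IsScalarTower.of_compHom k (Lam k) L
  obtain ⟨g, hg⟩ := (i.restrictScalars k).exists_leftInverse_of_injective
    (LinearMap.ker_eq_bot.2 hi)
  have hg' (a : Lam k) : g (i a) = a := LinearMap.congr_fun hg a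
  have hs (a : Lam k) (y : L) :
      (g (a • y)).snd = a.fst * (g y).snd + a.snd * (g ((ε : Lam k) • y)).snd := by
    rw [lam_smul_eq, algebraMap_smul, algebraMap_smul, map_add, map_smul, map_smul]
    simp
  -- For any `𝐤`-linear form `φ` on `L`, the map `y ↦ φ(xy) + φ(y)x` is linear over `𝐤[x]/(x²)`, a
  -- Frobenius algebra whose form takes the coefficient of `x`. Here `φ` is that form composed with
  -- the `𝐤`-linear retraction `g`, and the resulting map inherits the retraction property.
  refine ⟨
    { toFun := fun y => ((g ((ε : Lam k) • y)).snd, (g y).snd)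
      map_add' := fun y z => by
        rw [smul_add, map_add, map_add]; rfl
      map_smul' := fun a y => ?_ }, LinearMap.ext fun a => ?_⟩
  · apply TrivSqZeroExt.ext
    · change (g ((ε : Lam k) • a • y)).snd = a.fst * (g ((ε : Lam k) • y)).snd
      rw [smul_smul, hs]
      simp
    · change (g (a • y)).snd = a.fst • (g y).snd + MulOpposite.op (g ((ε : Lam k) • y)).snd • a.snd
      rw [hs]
      simp
  · apply TrivSqZeroExt.ext
    · change (g ((ε : Lam k) • i a)).snd = a.fst
      rw [← map_smul, hg']
      simp
    · change (g (i a)).snd = a.snd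
      rw [hg']

theorem simpleMod_mk_eq (a : Lam k) :
    (Submodule.Quotient.mk a : SimpleMod k) =
      Submodule.Quotient.mk (algebraMap k (Lam k) a.fst) := by
  rw [Submodule.Quotient.eq, Ideal.mem_span_singleton]
  refine ⟨algebraMap k (Lam k) a.snd, ?_⟩
  ext <;> simp [TrivSqZeroExt.algebraMap_eq_inl]

theorem epsZero_simpleMod : EpsZero k (SimpleMod k) := by
  intro m
  obtain ⟨a, rfl⟩ := Submodule.Quotient.mk_surjective _ m
  rw [← Submodule.Quotient.mk_smul, Submodule.Quotient.mk_eq_zero]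
  exact Ideal.mul_mem_right _ _ (Ideal.mem_span_singleton_self _)

theorem card_simpleMod : Nat.card (SimpleMod k) = Nat.card k := by
  symm
  refine Nat.card_congr (Equiv.ofBijective
    (fun c => (Submodule.Quotient.mk (algebraMap k (Lam k) c) : SimpleMod k)) ⟨fun c d h => ?_,
    fun m => ?_⟩)
  · have h' : (Submodule.Quotient.mk (algebraMap k (Lam k) c) : SimpleMod k) =
      Submodule.Quotient.mk (algebraMap k (Lam k) d) := h
    rw [Submodule.Quotient.eq, Ideal.mem_span_singleton] at h'
    obtain ⟨b, hb⟩ := h'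
    have := congrArg TrivSqZeroExt.fst hb
    simpa [TrivSqZeroExt.algebraMap_eq_inl, sub_eq_zero] using this
  · obtain ⟨a, rfl⟩ := Submodule.Quotient.mk_surjective _ m
    exact ⟨a.fst, (simpleMod_mk_eq a).symm⟩

variable [Finite k]

/-- Over a finite field the order of a vector space determines its dimension. -/
theorem EpsZero.nonempty_equiv [Finite M] [Finite N] (hM : EpsZero k M) (hN : EpsZero k N)
    (h : Nat.card M = Nat.card N) : Nonempty (M ≃ₗ[Lam k] N) := by
  let : Module k M := .compHom M (algebraMap k (Lam k))
  let : Module k N := .compHom N (algebraMap k (Lam k))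
  have : IsScalarTower k (Lam k) M := IsScalarTower.of_compHom k (Lam k) M
  have : IsScalarTower k (Lam k) N := IsScalarTower.of_compHom k (Lam k) N
  rw [Module.natCard_eq_pow_finrank (K := k) (V := M),
    Module.natCard_eq_pow_finrank (K := k) (V := N)] at h
  obtain ⟨e⟩ := FiniteDimensional.nonempty_linearEquiv_of_finrank_eq (R := k) (M := M) (M' := N)
    (Nat.pow_right_injective (Finite.one_lt_card (α := k)) h)
  exact ⟨LinearEquiv.ofBijective (hM.extend hN e) e.bijective⟩

instance : Finite (SimpleMod k) := Module.finite_of_finite (Lam k)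

theorem card_simpleMod_pi (n : ℕ) : Nat.card (Fin n → SimpleMod k) = Nat.card k ^ n := by
  rw [Nat.card_fun, card_simpleMod, Nat.card_fin]

theorem card_lam : Nat.card (Lam k) = Nat.card k ^ 2 := by
  rw [sq]
  exact Nat.card_prod k k

theorem EpsZero.card_linearMap [Finite M] [Finite N] (hM : EpsZero k M)
    (hM' : Nat.card M = Nat.card k) (hN : EpsZero k N) :
    Nat.card (M →ₗ[Lam k] N) = Nat.card N := by
  let : Module k M := .compHom M (algebraMap k (Lam k))
  let : Module k N := .compHom N (algebraMap k (Lam k))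
  have : IsScalarTower k (Lam k) M := IsScalarTower.of_compHom k (Lam k) M
  have : IsScalarTower k (Lam k) N := IsScalarTower.of_compHom k (Lam k) N
  have h1 : Module.finrank k M = 1 := by
    rw [Module.natCard_eq_pow_finrank (K := k) (V := M)] at hM'
    exact Nat.pow_right_injective (Finite.one_lt_card (α := k)) (hM'.trans (pow_one _).symm)
  let e : (M →ₗ[Lam k] N) ≃ (M →ₗ[k] N) :=
    { toFun := fun f => f.restrictScalars k
      invFun := fun f => hM.extend hN f
      left_inv := fun _ => rfl
      right_inv := fun _ => rfl }
  have : Finite (M →ₗ[k] N) := Finite.of_injective (fun e => (e : M → N)) DFunLike.coe_injective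
  rw [Nat.card_congr e, Module.natCard_eq_pow_finrank (K := k) (V := M →ₗ[k] N),
    Module.finrank_linearMap, h1, one_mul, ← Module.natCard_eq_pow_finrank]

/-- An extension of a simple module by a semisimple one is semisimple or has the free module of
rank one as a direct summand. -/
theorem nonempty_equiv_lam_prod [Finite M] [Finite N] [Finite L] (i : N →ₗ[Lam k] L)
    (p : L →ₗ[Lam k] M) (hi : Function.Injective i) (hip : LinearMap.range i = LinearMap.ker p)
    (hp : Function.Surjective p) (hM' : Nat.card M = Nat.card k)
    (hN : EpsZero k N) {n : ℕ} (hN' : Nat.card N = Nat.card k ^ (n + 1)) (hL : ¬ EpsZero k L) :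
    Nonempty (L ≃ₗ[Lam k] Lam k × (Fin n → SimpleMod k)) := by
  have hk (y : L) (hy : p y = 0) : (ε : Lam k) • y = 0 := by
    obtain ⟨x, rfl⟩ : y ∈ LinearMap.range i := hip ▸ hy
    rw [← map_smul, hN, map_zero]
  obtain ⟨l, hl⟩ : ∃ l : L, (ε : Lam k) • l ≠ 0 := by simpa [EpsZero] using hL
  let : Module k M := .compHom M (algebraMap k (Lam k))
  let : Module k L := .compHom L (algebraMap k (Lam k))
  have : IsScalarTower k (Lam k) M := IsScalarTower.of_compHom k (Lam k) M
  have : IsScalarTower k (Lam k) L := IsScalarTower.of_compHom k (Lam k) L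
  have h1 : Module.finrank k M = 1 := by
    rw [Module.natCard_eq_pow_finrank (K := k) (V := M)] at hM'
    exact Nat.pow_right_injective (Finite.one_lt_card (α := k)) (hM'.trans (pow_one _).symm)
  -- The element `l` generates a free submodule. If `a • l = 0`, multiplying by `x` leaves `a.fst •
  -- (x • l) = 0`, so `a.fst = 0`; what remains is `a.snd • (x • l) = 0`.
  have hinj : Function.Injective (LinearMap.toSpanSingleton (Lam k) L l) := by
    rw [injective_iff_map_eq_zero]
    intro a ha
    rw [LinearMap.toSpanSingleton_apply] at ha
    have h0 : a.fst = 0 := by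
      have h' : (ε : Lam k) • a • l = 0 := by rw [ha, smul_zero]
      rw [smul_comm, lam_smul_eq, smul_smul (ε : Lam k), eps_mul_eps, zero_smul, smul_zero,
        add_zero, algebraMap_smul] at h'
      exact (smul_eq_zero.1 h').resolve_right hl
    rw [lam_smul_eq, h0, map_zero, zero_smul, zero_add, algebraMap_smul] at ha
    exact TrivSqZeroExt.ext h0 ((smul_eq_zero.1 ha).resolve_right hl)
  obtain ⟨r, hr⟩ := lam_exists_retraction _ hinj
  have hrl (a : Lam k) : r (a • l) = a := LinearMap.congr_fun hr a
  have hrs : Function.Surjective r := fun a => ⟨a • l, hrl a⟩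
  -- As `M` is a line spanned by `p l`, each `y` in the kernel of `r` equals `c • l` up to an
  -- element of `N`, so `x • y = (x * c) • l`. Applying `r` gives `x * c = 0`, and hence `x • y =
  -- 0`.
  have hker : EpsZero k (LinearMap.ker r) := by
    rintro ⟨y, hy⟩
    apply Subtype.ext
    change (ε : Lam k) • y = 0
    have hpl : p l ≠ 0 := fun h => hl (hk l h)
    obtain ⟨c, hc⟩ := exists_smul_eq_of_finrank_eq_one h1 hpl (p y)
    have h2 : (ε : Lam k) • (y - algebraMap k (Lam k) c • l) = 0 :=
      hk _ (by rw [map_sub, map_smul, algebraMap_smul, hc, sub_self])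
    rw [smul_sub, sub_eq_zero, smul_smul] at h2
    have h3 : r ((ε : Lam k) • y) = 0 := by
      rw [map_smul, LinearMap.mem_ker.1 hy, smul_zero]
    rw [h2, hrl] at h3
    rw [h2, h3, zero_smul]
  let e : (LinearMap.ker r × Lam k) ≃ₗ[Lam k] L :=
    lequivProdOfRightSplitExact (LinearMap.ker r).injective_subtype
      (Submodule.range_subtype _) hr
  -- Counting elements determines the number of simple summands: the order of `L` is `q^(n+2)`, and
  -- the free summand takes `q^2`.
  have hcard : Nat.card (LinearMap.ker r) = Nat.card k ^ n := by
    have h2 := Nat.card_congr e.toEquiv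
    have h3 : Nat.card L = Nat.card N * Nat.card M := by
      rw [Submodule.card_eq_card_quotient_mul_card (LinearMap.range i)]
      rw [← Nat.card_congr (LinearEquiv.ofInjective i hi).toEquiv,
        Nat.card_congr ((Submodule.quotEquivOfEq _ _ hip).trans
          (LinearMap.quotKerEquivOfSurjective p hp)).toEquiv]
    rw [Nat.card_prod, card_lam, h3, hM', hN', ← pow_succ, add_assoc, pow_add _ n] at h2
    exact Nat.eq_of_mul_eq_mul_right (pow_pos (Nat.card_pos (α := k)) 2) h2
  obtain ⟨e'⟩ := hker.nonempty_equiv (epsZero_simpleMod.pi n)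
    (hcard.trans (card_simpleMod_pi n).symm)
  exact ⟨e.symm.trans ((LinearEquiv.prodComm _ _ _).trans
    ((LinearEquiv.refl _ _).prodCongr e'))⟩

end LamModules

end IHall

namespace IHall

open DualNumber

/-! ### Products of basis vectors in the twisted Hall algebra -/

section HallProducts

variable {k : Type u} [Field k] [Finite k]

theorem vv_sq : vv k ^ 2 = (Nat.card k : QSqrt (Nat.card k)) := by
  apply Subtype.ext
  change Real.sqrt (Nat.card k) ^ 2 = _
  rw [Real.sq_sqrt (Nat.cast_nonneg _)]
  simp

theorem mul_basisVec (X Y : IsoClass (Lam k)) : basisVec X * basisVec Y = hallProd X Y :=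
  mulMap_basisVec X Y

theorem card_rep_mk (M : Type u) [AddCommGroup M] [Module (Lam k) M] [Module.Finite (Lam k) M] :
    Nat.card (IsoClass.mk (Lam k) M).rep = Nat.card M :=
  Nat.card_congr (IsoClass.rep_mk (A := Lam k) M).some.toEquiv

theorem EpsZero.rep_mk {M : Type u} [AddCommGroup M] [Module (Lam k) M]
    [Module.Finite (Lam k) M] (hM : EpsZero k M) : EpsZero k (IsoClass.mk (Lam k) M).rep :=
  hM.of_injective _ (IsoClass.rep_mk (A := Lam k) M).some.injective

theorem finrank_res_eq {M : FGModuleCat.{u} (Lam k)} {n : ℕ} (h : Nat.card M = Nat.card k ^ n) :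
    Module.finrank k (res M) = n := by
  rw [card_rep] at h
  exact Nat.pow_right_injective (Finite.one_lt_card (α := k)) h

/-- All orders are powers of `q = 𝐯²`, so the Euler twist and the division by `|Hom|` merge into one
power of `𝐯`. -/
theorem tcoeff_eq {X Y : IsoClass (Lam k)} {a b h : ℕ} (hX : Nat.card X.rep = Nat.card k ^ a)
    (hY : Nat.card Y.rep = Nat.card k ^ b)
    (hXY : Nat.card (X.rep →ₗ[Lam k] Y.rep) = Nat.card k ^ h) (Z : IsoClass (Lam k)) :
    tcoeff X Y Z = vv k ^ (a * b) / vv k ^ (2 * h) * Nat.card (extMid X.rep Y.rep Z.rep) := by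
  rw [tcoeff, euler_eq, finrank_res_eq hX, finrank_res_eq hY, hallCoeff,
    Nat.card_congr (homEquiv X.rep Y.rep), hXY, pow_mul (vv k) 2 h, vv_sq, ← Nat.cast_mul, zpow_natCast]
  push_cast
  ring

theorem card_linearMap_congr {M M' N N' : Type u} [AddCommGroup M] [Module (Lam k) M]
    [AddCommGroup N] [Module (Lam k) N] [AddCommGroup M'] [Module (Lam k) M']
    [AddCommGroup N'] [Module (Lam k) N'] (e : M ≃ₗ[Lam k] M') (e' : N ≃ₗ[Lam k] N') :
    Nat.card (M →ₗ[Lam k] N) = Nat.card (M' →ₗ[Lam k] N') :=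
  Nat.card_congr (e.arrowCongr e').toEquiv

/-- The product of two classes without non-split extensions. -/
theorem basisVec_mul_of_split {M N : Type u} [AddCommGroup M] [Module (Lam k) M]
    [Module.Finite (Lam k) M] [AddCommGroup N] [Module (Lam k) N] [Module.Finite (Lam k) N]
    {a b h : ℕ} (hM : Nat.card M = Nat.card k ^ a) (hN : Nat.card N = Nat.card k ^ b)
    (hMN : Nat.card (M →ₗ[Lam k] N) = Nat.card k ^ h) (hh : a * b = 2 * h)
    (hs : ∀ (L : FGModuleCat.{u} (Lam k))
      (c : Confl (IsoClass.mk (Lam k) M).rep (IsoClass.mk (Lam k) N).rep L),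
      ∃ r : L →ₗ[Lam k] (IsoClass.mk (Lam k) N).rep, r ∘ₗ c.i.hom.hom = LinearMap.id) :
    basisVec (IsoClass.mk (Lam k) M) * basisVec (IsoClass.mk (Lam k) N) =
      basisVec (IsoClass.mk (Lam k) (M × N)) := by
  classical
  rw [mul_basisVec]
  refine coord_ext fun Z => ?_
  obtain ⟨eM⟩ := IsoClass.rep_mk (A := Lam k) M
  obtain ⟨eN⟩ := IsoClass.rep_mk (A := Lam k) N
  -- The condition `hh` says that the twist `𝐯^(ab)` cancels `|Hom| = 𝐯^(2h)`, so the coefficient is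
  -- the number of extension classes, which is 1 for the direct sum and 0 otherwise.
  rw [coord_hallProd, coord_basisVec, tcoeff_eq ((card_rep_mk M).trans hM)
    ((card_rep_mk N).trans hN) ((card_linearMap_congr eM eN).trans hMN), hh,
    div_self (pow_ne_zero _ (vv_ne_zero k)), one_mul, card_extMid_of_split _ (hs _), Nat.cast_ite,
    Nat.cast_one, Nat.cast_zero]
  refine if_congr ?_ rfl rfl
  rw [eq_comm, IsoClass.eq_mk_iff]
  constructor
  · rintro ⟨e⟩
    exact ⟨e.trans (eM.prodCongr eN)⟩
  · rintro ⟨e⟩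
    exact ⟨e.trans (eM.prodCongr eN).symm⟩

/-- `[𝕂] * [M] = [𝕂 ⊕ M]`. -/
theorem basisVec_lam_mul {M : Type u} [AddCommGroup M] [Module (Lam k) M]
    [Module.Finite (Lam k) M] {m : ℕ} (hM : Nat.card M = Nat.card k ^ m) :
    basisVec (IsoClass.mk (Lam k) (Lam k)) * basisVec (IsoClass.mk (Lam k) M) =
      basisVec (IsoClass.mk (Lam k) (Lam k × M)) := by
  refine basisVec_mul_of_split (a := 2) (b := m) (h := m) card_lam hM ?_ rfl fun L c => ?_
  · rw [← hM]
    exact Nat.card_congr (LinearMap.ringLmapEquivSelf (Lam k) (Lam k) M).toEquiv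
  · obtain ⟨e⟩ := IsoClass.rep_mk (A := Lam k) (Lam k)
    have : Module.Projective (Lam k) (IsoClass.mk (Lam k) (Lam k)).rep :=
      Module.Projective.of_equiv e.symm
    have := fgModuleCat_projective (IsoClass.mk (Lam k) (Lam k)).rep
    exact c.exists_retraction_iff.1 (c.cls_eq_zero_iff.1 (Abelian.Ext.eq_zero_of_projective _))

/-- A map out of `S` lands in the part of `𝕂` killed by `x`, which is the line spanned by `x`. -/
theorem card_linearMap_simpleMod_lam :
    Nat.card (SimpleMod k →ₗ[Lam k] Lam k) = Nat.card k ^ 1 := by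
  let U : Submodule (Lam k) (Lam k) := LinearMap.ker (LinearMap.lsmul (Lam k) (Lam k) (ε : Lam k))
  have hU : EpsZero k U := fun u => Subtype.ext u.2
  let e : (SimpleMod k →ₗ[Lam k] Lam k) ≃ (SimpleMod k →ₗ[Lam k] U) :=
    { toFun := fun f => f.codRestrict U fun x => by
        change (ε : Lam k) • f x = 0
        rw [← map_smul, epsZero_simpleMod, map_zero]
      invFun := fun f => U.subtype ∘ₗ f
      left_inv := fun _ => rfl
      right_inv := fun _ => rfl }
  rw [Nat.card_congr e, epsZero_simpleMod.card_linearMap card_simpleMod hU, pow_one]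
  refine Nat.card_congr
    { toFun := fun u => u.1.snd
      invFun := fun c => ⟨TrivSqZeroExt.inr c, by
        change (ε : Lam k) * TrivSqZeroExt.inr c = 0
        ext <;> simp⟩
      left_inv := fun u => ?_
      right_inv := fun c => rfl }
  have h : (ε : Lam k) * u.1 = 0 := u.2
  have h0 : u.1.fst = 0 := by simpa using congrArg TrivSqZeroExt.snd h
  apply Subtype.ext
  exact TrivSqZeroExt.ext h0.symm rfl

/-- `[S] * [𝕂] = [S ⊕ 𝕂]`. -/
theorem basisVec_simpleMod_mul_lam :
    basisVec (IsoClass.mk (Lam k) (SimpleMod k)) * basisVec (IsoClass.mk (Lam k) (Lam k)) =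
      basisVec (IsoClass.mk (Lam k) (SimpleMod k × Lam k)) := by
  refine basisVec_mul_of_split (a := 1) (b := 2) (h := 1)
    (card_simpleMod.trans (pow_one _).symm) card_lam card_linearMap_simpleMod_lam rfl fun L c => ?_
  obtain ⟨e⟩ := IsoClass.rep_mk (A := Lam k) (Lam k)
  obtain ⟨hi, -, -⟩ := (shortExact_iff c.i c.p c.zero).1 c.exact
  obtain ⟨r, hr⟩ := lam_exists_retraction (c.i.hom.hom ∘ₗ e.symm.toLinearMap)
    (hi.comp e.symm.injective)
  refine ⟨e.symm.toLinearMap ∘ₗ r, LinearMap.ext fun x => ?_⟩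
  have h := LinearMap.congr_fun hr (e x)
  change r (c.i.hom.hom (e.symm (e x))) = e x at h
  rw [e.symm_apply_apply] at h
  change e.symm (r (c.i.hom.hom x)) = x
  rw [h, e.symm_apply_apply]

/-- The middle terms of the extensions of a simple module by a semisimple one. -/
theorem card_extMid_simple {M N : FGModuleCat.{u} (Lam k)} {n : ℕ} (hM : EpsZero k M)
    (hM' : Nat.card M = Nat.card k) (hN : EpsZero k N) (hN' : Nat.card N = Nat.card k ^ (n + 1))
    (L : FGModuleCat.{u} (Lam k)) :
    (Nonempty (L ≃ₗ[Lam k] M × N) → Nat.card (extMid M N L) = 1) ∧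
    (Nonempty (L ≃ₗ[Lam k] Lam k × (Fin n → SimpleMod k)) →
      Nat.card (extMid M N L) = Nat.card k ^ (n + 1) - 1) ∧
    (¬ Nonempty (L ≃ₗ[Lam k] M × N) → ¬ Nonempty (L ≃ₗ[Lam k] Lam k × (Fin n → SimpleMod k)) →
      Nat.card (extMid M N L) = 0) := by
  have hsplit {L : FGModuleCat.{u} (Lam k)} (c : Confl M N L) (hL : EpsZero k L) :
      c.cls = 0 :=
    c.cls_eq_zero_iff.2 (c.exists_retraction_iff.2 (hN.exists_retraction hL _
      ((shortExact_iff c.i c.p c.zero).1 c.exact).1))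
  have hclass {L : FGModuleCat.{u} (Lam k)} (c : Confl M N L) (hL : ¬ EpsZero k L) :
      Nonempty (L ≃ₗ[Lam k] Lam k × (Fin n → SimpleMod k)) := by
    obtain ⟨h₁, h₂, h₃⟩ := (shortExact_iff c.i c.p c.zero).1 c.exact
    exact nonempty_equiv_lam_prod _ _ h₁ h₂ h₃ hM' hN hN' hL
  have hsemi {L : FGModuleCat.{u} (Lam k)} (h : Nonempty (L ≃ₗ[Lam k] M × N)) : EpsZero k L :=
    (hM.prod hN).of_injective _ h.some.injective
  have hfree {L : FGModuleCat.{u} (Lam k)}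
      (h : Nonempty (L ≃ₗ[Lam k] Lam k × (Fin n → SimpleMod k))) : ¬ EpsZero k L := by
    intro h'
    have h1 := h'.of_injective h.some.symm.toLinearMap h.some.symm.injective (1, 0)
    have h2 : (ε : Lam k) * 1 = 0 := congrArg Prod.fst h1
    have h3 := congrArg TrivSqZeroExt.snd h2
    simp at h3
  refine ⟨fun h => ?_, fun h => ?_, fun h h' => ?_⟩
  · classical
    rw [card_extMid_of_split, if_pos h]
    exact fun c => c.exists_retraction_iff.1 (c.cls_eq_zero_iff.1 (hsplit c (hsemi h)))
  -- The ideal `I = (x)` and its quotient are both copies of the simple module, so `0 → M → 𝕂 → M →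
  -- 0` is a projective presentation of `M`. Every map `𝕂 → N` vanishes on `I` because `x` kills
  -- `N`, and therefore `Ext¹(M, N)` is a copy of `Hom(M, N)`, with `q^(n+1)` elements.
  · let I : Submodule (Lam k) (Lam k) := Ideal.span {(ε : Lam k)}
    have hI : EpsZero k I := by
      rintro ⟨x, hx⟩
      obtain ⟨b, rfl⟩ := Ideal.mem_span_singleton.1 hx
      apply Subtype.ext
      change (ε : Lam k) * (ε * b) = 0
      rw [← mul_assoc, eps_mul_eps, zero_mul]
    have hI' : Nat.card I = Nat.card k := by
      have h1 := Submodule.card_eq_card_quotient_mul_card I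
      rw [card_lam] at h1
      have h2 : Nat.card (Lam k ⧸ I) = Nat.card k := card_simpleMod
      rw [h2, sq] at h1
      exact (Nat.eq_of_mul_eq_mul_right Nat.card_pos h1).symm
    obtain ⟨e⟩ := hM.nonempty_equiv hI (hM'.trans hI'.symm)
    obtain ⟨e'⟩ := (epsZero_simpleMod (k := k)).nonempty_equiv hM (card_simpleMod.trans hM'.symm)
    let c : Confl M M (FGModuleCat.of (Lam k) (Lam k)) := conflMk I e e'
    have : Module.Projective (Lam k) (FGModuleCat.of (Lam k) (Lam k)) :=
      inferInstanceAs (Module.Projective (Lam k) (Lam k))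
    have := fgModuleCat_projective (FGModuleCat.of (Lam k) (Lam k))
    have hcard : Nat.card (Abelian.Ext M N 1) = Nat.card k ^ (n + 1) := by
      rw [c.card_ext_eq N, Nat.card_congr (homEquiv M N), hM.card_linearMap hM' hN, hN']
      intro g
      ext x
      change g.hom.hom (e x).1 = 0
      obtain ⟨b, hb⟩ := Ideal.mem_span_singleton.1 (e x).2
      rw [hb]
      exact (g.hom.hom.map_smul (ε : Lam k) b).trans (hN _)
    have : Finite (Abelian.Ext M N 1) :=
      Nat.finite_of_card_ne_zero (hcard ▸ pow_ne_zero _ (Nat.card_pos (α := k)).ne')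
    -- A class with semisimple middle term splits, so a nonzero class has a middle term on which `x`
    -- acts nontrivially, and `hclass` leaves only one such module. Conversely the zero class has
    -- the semisimple middle term `M × N`, which is not `L`.
    have hset : extMid M N L = {0}ᶜ := by
      ext x
      rw [Set.mem_compl_singleton_iff]
      constructor
      · rintro hx rfl
        exact hfree h (hsemi (zero_mem_extMid_iff.1 hx))
      · intro hx
        obtain ⟨L', d, rfl⟩ := c.exists_cls_eq N x
        obtain ⟨f⟩ := hclass d fun h0 => hx (hsplit d h0)
        exact extMid_of_iso d (f.trans h.some.symm).toFGModuleCatIso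
    rw [hset, Nat.card_coe_set_eq, Set.ncard_compl, Set.ncard_singleton, hcard]
  · rw [Nat.card_eq_zero]
    left
    rw [Set.isEmpty_coe_sort, Set.eq_empty_iff_forall_notMem]
    rintro _ ⟨f, g, z, hs, rfl⟩
    let c : Confl M N L := ⟨f, g, z, hs⟩
    by_cases hL : EpsZero k L
    · exact h (c.nonempty_equiv_prod (c.exists_retraction_iff.1
        (c.cls_eq_zero_iff.1 (hsplit c hL))))
    · exact h' (hclass c hL)

/-- `[S] * [(n+1)S] = 𝐯^{-(n+1)} [(n+2)S] + (𝐯^{n+1} - 𝐯^{-(n+1)}) [𝕂 ⊕ nS]`. -/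
theorem basisVec_simpleMod_mul (n : ℕ) :
    basisVec (IsoClass.mk (Lam k) (SimpleMod k)) *
        basisVec (IsoClass.mk (Lam k) (Fin (n + 1) → SimpleMod k)) =
      (vv k ^ (n + 1))⁻¹ • basisVec (IsoClass.mk (Lam k) (Fin (n + 2) → SimpleMod k)) +
      (vv k ^ (n + 1) - (vv k ^ (n + 1))⁻¹) •
        basisVec (IsoClass.mk (Lam k) (Lam k × (Fin n → SimpleMod k))) := by
  classical
  rw [mul_basisVec]
  refine coord_ext fun Z => ?_
  let X := IsoClass.mk (Lam k) (SimpleMod k)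
  let Y := IsoClass.mk (Lam k) (Fin (n + 1) → SimpleMod k)
  have hX : EpsZero k X.rep := epsZero_simpleMod.rep_mk
  have hY : EpsZero k Y.rep := (epsZero_simpleMod.pi (n + 1)).rep_mk
  have hX' : Nat.card X.rep = Nat.card k := (card_rep_mk _).trans card_simpleMod
  have hY' : Nat.card Y.rep = Nat.card k ^ (n + 1) :=
    (card_rep_mk _).trans (card_simpleMod_pi _)
  have hXY : Nat.card (X.rep →ₗ[Lam k] Y.rep) = Nat.card k ^ (n + 1) :=
    (hX.card_linearMap hX' hY).trans hY'
  have h1 : IsoClass.mk (Lam k) (Fin (n + 2) → SimpleMod k) = Z ↔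
      Nonempty (Z.rep ≃ₗ[Lam k] X.rep × Y.rep) := by
    rw [eq_comm, IsoClass.eq_mk_iff]
    have hc : Nat.card (Fin (n + 2) → SimpleMod k) = Nat.card (X.rep × Y.rep) := by
      rw [card_simpleMod_pi, Nat.card_prod, hX', hY', ← pow_succ']
    obtain ⟨e⟩ := ((epsZero_simpleMod (k := k)).pi (n + 2)).nonempty_equiv (hX.prod hY) hc
    exact ⟨fun ⟨f⟩ => ⟨f.trans e⟩, fun ⟨f⟩ => ⟨f.trans e.symm⟩⟩
  have h2 : IsoClass.mk (Lam k) (Lam k × (Fin n → SimpleMod k)) = Z ↔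
      Nonempty (Z.rep ≃ₗ[Lam k] Lam k × (Fin n → SimpleMod k)) := by
    rw [eq_comm, IsoClass.eq_mk_iff]
  have h3 : ¬ (IsoClass.mk (Lam k) (Fin (n + 2) → SimpleMod k) = Z ∧
      IsoClass.mk (Lam k) (Lam k × (Fin n → SimpleMod k)) = Z) := by
    rintro ⟨h, h'⟩
    obtain ⟨e⟩ := IsoClass.mk_eq_mk_iff.1 (h'.trans h.symm)
    have h1 := ((epsZero_simpleMod (k := k)).pi (n + 2)).of_injective _ e.injective (1, 0)
    have h2 : (ε : Lam k) * 1 = 0 := congrArg Prod.fst h1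
    have h3 := congrArg TrivSqZeroExt.snd h2
    simp at h3
  obtain ⟨c1, c2, c3⟩ := card_extMid_simple hX hX' hY hY' Z.rep
  rw [← h1] at c1 c3
  rw [← h2] at c2 c3
  have hv := vv_ne_zero k
  rw [coord_hallProd, tcoeff_eq (hX'.trans (pow_one _).symm) hY' hXY]
  simp only [map_add, map_smul, coord_basisVec, smul_eq_mul, mul_ite, mul_one, mul_zero]
  -- The common factor is `𝐯^(n+1) / 𝐯^(2(n+1)) = 𝐯^{-(n+1)}`. It is multiplied by 1 for the split
  -- extension and by `q^(n+1) - 1 = 𝐯^(2(n+1)) - 1` for the nonsplit ones.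
  split_ifs with ha hb hb
  · exact absurd ⟨ha, hb⟩ h3
  · rw [c1 ha]
    field_simp
    ring
  · rw [c2 hb, Nat.cast_sub (Nat.one_le_pow _ _ Nat.card_pos), Nat.cast_pow, ← vv_sq]
    field_simp
    ring
  · rw [c3 ha hb]
    simp

end HallProducts

/-! ### Relations between `[S]`, `[mS]` and `[𝕂]` in the `ı`Hall algebra -/

section HallClasses

variable (k : Type u) [Field k] [Finite k]

theorem clsNS_zero : clsNS k 0 = 1 := by
  have h : basisVec (IsoClass.mk (Lam k) (Fin 0 → SimpleMod k)) = (1 : TwistedHall k) := by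
    change _ = basisVec (IsoClass.mk (Lam k) PUnit)
    congr 1
    refine IsoClass.mk_eq_mk_iff.2 ((epsZero_simpleMod.pi 0).nonempty_equiv
      (fun _ => rfl) ?_)
    rw [Nat.card_unique, Nat.card_unique]
  rw [clsNS, hallClass, h, map_one, map_one]

theorem clsNS_one : clsNS k 1 = clsS k := by
  have h : IsoClass.mk (Lam k) (Fin 1 → SimpleMod k) = IsoClass.mk (Lam k) (SimpleMod k) :=
    IsoClass.mk_eq_mk_iff.2 ⟨LinearEquiv.funUnique (Fin 1) (Lam k) (SimpleMod k)⟩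
  rw [clsNS, clsS, hallClass, hallClass, h]

theorem clsK_mul_clsS : clsK k * clsS k = clsS k * clsK k := by
  have h : IsoClass.mk (Lam k) (SimpleMod k × Lam k) = IsoClass.mk (Lam k) (Lam k × SimpleMod k) :=
    IsoClass.mk_eq_mk_iff.2 ⟨LinearEquiv.prodComm _ _ _⟩
  simp only [clsK, clsS, hallClass, ← map_mul]
  rw [basisVec_simpleMod_mul_lam, basisVec_lam_mul (m := 1) (by rw [card_simpleMod, pow_one]), h]

theorem clsS_mul_clsNS_succ (n : ℕ) :
    clsS k * clsNS k (n + 1) = (vv k ^ (n + 1))⁻¹ • clsNS k (n + 2) +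
      (vv k ^ (n + 1) - (vv k ^ (n + 1))⁻¹) • (clsK k * clsNS k n) := by
  simp only [clsK, clsS, clsNS, hallClass, ← map_mul, ← map_smul, ← map_add]
  rw [basisVec_simpleMod_mul, basisVec_lam_mul (card_simpleMod_pi n)]

/-- The product formula has an invertible coefficient at `[(n+2)S]`, so this class is a combination
of `[S] * [(n+1)S]` and `[𝕂] * [nS]`. Commutation with `[𝕂]` thus descends by strong induction to
the case of `[S]`. -/
theorem clsK_mul_clsNS (n : ℕ) : clsK k * clsNS k n = clsNS k n * clsK k := by
  induction n using Nat.strong_induction_on with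
  | _ n ih =>
    match n with
    | 0 => rw [clsNS_zero, mul_one, one_mul]
    | 1 => rw [clsNS_one, clsK_mul_clsS]
    | n + 2 =>
      have h := clsS_mul_clsNS_succ k n
      have hv : vv k ^ (n + 1) ≠ 0 := pow_ne_zero _ (vv_ne_zero k)
      rw [← sub_eq_iff_eq_add] at h
      rw [eq_comm, inv_smul_eq_iff₀ hv] at h
      have h0 := ih n (by omega)
      have h1 := ih (n + 1) (by omega)
      rw [h, mul_smul_comm, smul_mul_assoc, mul_sub, sub_mul, mul_smul_comm, smul_mul_assoc,
        ← mul_assoc, clsK_mul_clsS, mul_assoc, h1, ← mul_assoc, mul_assoc (clsK k) (clsNS k n), h0]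

theorem clsS_mul_clsNS (n : ℕ) :
    clsS k * clsNS k n = (vv k ^ n)⁻¹ • clsNS k (n + 1) +
      (vv k ^ n - (vv k ^ n)⁻¹) • (clsNS k (n - 1) * clsK k) := by
  cases n with
  -- Here `n - 1` truncates to 0, which is harmless because its coefficient `𝐯⁰ - 𝐯⁰` vanishes.
  | zero => simp [clsNS_zero, clsNS_one]
  | succ n => rw [clsS_mul_clsNS_succ, clsK_mul_clsNS, Nat.add_sub_cancel]

end HallClasses

end IHall

namespace IHall

/-! ### Quantum integers and identities between the coefficients -/

section Coefficients

variable (k : Type u) [Field k] [Finite k]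

theorem one_lt_vv : (1 : ℝ) < (vv k : ℝ) := by
  change 1 < Real.sqrt (Nat.card k)
  rw [Real.lt_sqrt zero_le_one, one_pow]
  exact_mod_cast Finite.one_lt_card (α := k)

/-- The real number `√q` exceeds 1, so its integral powers are distinct. This makes every `[r]` with
`r ≠ 0` invertible, as the divisions by quantum factorials require. -/
theorem vv_zpow_injective : Function.Injective (fun r : ℤ => vv k ^ r) := fun r s h => by
  refine zpow_right_injective₀ (zero_lt_one.trans (one_lt_vv k)) (one_lt_vv k).ne' ?_
  have h' : ((vv k ^ r : QSqrt (Nat.card k)) : ℝ) = (vv k ^ s : QSqrt (Nat.card k)) :=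
    congrArg Subtype.val h
  exact h'

theorem vv_sub_inv_ne_zero : vv k - (vv k)⁻¹ ≠ 0 := by
  intro h
  have h1 : vv k ^ (1 : ℤ) = vv k ^ (-1 : ℤ) := by simpa [sub_eq_zero] using h
  exact absurd (vv_zpow_injective k h1) (by norm_num)

theorem qInt_ne_zero {r : ℤ} (hr : r ≠ 0) : qInt k r ≠ 0 := by
  refine div_ne_zero (fun h => hr ?_) (vv_sub_inv_ne_zero k)
  have := vv_zpow_injective k (sub_eq_zero.1 h)
  omega

theorem sub_inv_mul_qInt (r : ℤ) : (vv k - (vv k)⁻¹) * qInt k r = vv k ^ r - vv k ^ (-r) :=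
  mul_div_cancel₀ _ (vv_sub_inv_ne_zero k)

theorem qFact_succ (m : ℕ) : qFact k (m + 1) = qFact k m * qInt k (m + 1 : ℕ) := by
  rw [qFact, Finset.prod_Icc_succ_top (by omega)]; rfl

theorem qDoubleFact_succ (m : ℕ) :
    qDoubleFact k (m + 1) = qDoubleFact k m * qInt k (2 * (m + 1 : ℕ)) := by
  rw [qDoubleFact, Finset.prod_Icc_succ_top (by omega)]; rfl

theorem qFact_ne_zero (m : ℕ) : qFact k m ≠ 0 :=
  Finset.prod_ne_zero_iff.2 fun i hi => qInt_ne_zero k (by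
    have := (Finset.mem_Icc.1 hi).1
    omega)

theorem qDoubleFact_ne_zero (m : ℕ) : qDoubleFact k m ≠ 0 :=
  Finset.prod_ne_zero_iff.2 fun i hi => qInt_ne_zero k (by
    have := (Finset.mem_Icc.1 hi).1
    omega)

/-- The coefficient of `[mS] * [𝕂]^i` in an `ı`divided power. -/
noncomputable def idpCoeff (σ : ℤ) (m i : ℕ) : QSqrt (Nat.card k) :=
  vv k ^ ((i : ℤ) * ((i : ℤ) - σ) - (m.choose 2 : ℕ)) * (vv k - (vv k)⁻¹) ^ i /
    (qFact k m * qDoubleFact k i)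

theorem choose_two_succ (m : ℕ) : (((m + 1).choose 2 : ℕ) : ℤ) = m + (m.choose 2 : ℕ) := by
  rw [Nat.choose_succ_succ' m 1]; simp

/-- Lowering the number of simple summands. -/
theorem idpCoeff_succ_left (σ τ : ℤ) (m i : ℕ) :
    idpCoeff k τ m i =
      vv k ^ (i * (σ - τ) + m) * qInt k (m + 1 : ℕ) * idpCoeff k σ (m + 1) i := by
  have h1 := qFact_ne_zero k m
  have h2 := qInt_ne_zero k (r := (m + 1 : ℕ)) (by omega)
  have h3 := qDoubleFact_ne_zero k i
  have e : vv k ^ ((i : ℤ) * (i - τ) - (m.choose 2 : ℕ)) =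
      vv k ^ (i * (σ - τ) + m) * vv k ^ ((i : ℤ) * (i - σ) - ((m + 1).choose 2 : ℕ)) := by
    rw [← zpow_add₀ (vv_ne_zero k), choose_two_succ]
    congr 1; ring
  rw [idpCoeff, idpCoeff, e, qFact_succ]
  field_simp

/-- Raising the number of free summands. -/
theorem idpCoeff_succ_right (σ τ : ℤ) (m i : ℕ) :
    (vv k - (vv k)⁻¹) * idpCoeff k τ m i =
      vv k ^ (i * (σ - τ) - 2 * i - 1 + σ) * qInt k (2 * (i + 1 : ℕ)) * idpCoeff k σ m (i + 1) := by
  have h1 := qFact_ne_zero k m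
  have h2 := qInt_ne_zero k (r := 2 * (i + 1 : ℕ)) (by omega)
  have h3 := qDoubleFact_ne_zero k i
  have e : vv k ^ ((i : ℤ) * (i - τ) - (m.choose 2 : ℕ)) =
      vv k ^ (i * (σ - τ) - 2 * i - 1 + σ) *
        vv k ^ (((i + 1 : ℕ) : ℤ) * ((i + 1 : ℕ) - σ) - (m.choose 2 : ℕ)) := by
    rw [← zpow_add₀ (vv_ne_zero k)]
    congr 1; push_cast; ring
  rw [idpCoeff, idpCoeff, e, qDoubleFact_succ, pow_succ]
  field_simp

/-- Comparison at `[(n+1)S]`, the term of both recursions without `𝕂`. The signs `σ` and `τ` are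
arbitrary because they enter the coefficients multiplied by `i = 0`. -/
theorem idpCoeff_succ_zero (σ τ : ℤ) (n : ℕ) :
    qInt k (n + 1 : ℕ) * idpCoeff k σ (n + 1) 0 = idpCoeff k τ n 0 * (vv k ^ n)⁻¹ := by
  have hv := vv_ne_zero k
  rw [idpCoeff_succ_left k σ τ n 0]
  simp only [Nat.cast_zero, zero_mul, zero_add, zpow_natCast]
  field_simp

/-- The contribution of the free module in `[S] * [(m+1)S]`. -/
theorem idpCoeff_mul_sub (σ τ : ℤ) (m i : ℕ) :
    idpCoeff k τ (m + 1) i * (vv k ^ (m + 1) - (vv k ^ (m + 1))⁻¹) =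
      vv k ^ (i * (σ - τ) - 2 * i - 1 + σ - m) * qInt k (2 * (i + 1 : ℕ)) *
        idpCoeff k σ m (i + 1) := by
  -- The difference factors as `(𝐯 - 𝐯⁻¹) [m+1]`. The factor `[m+1]` is absorbed by lowering `m + 1`
  -- to `m`, and `𝐯 - 𝐯⁻¹` by raising `i` to `i + 1`.
  have h1 := idpCoeff_succ_left k τ τ m i
  have h2 := idpCoeff_succ_right k σ τ m i
  have h3 := sub_inv_mul_qInt k (m + 1 : ℕ)
  have hm : vv k ^ m ≠ 0 := pow_ne_zero _ (vv_ne_zero k)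
  rw [sub_self, mul_zero, zero_add, zpow_natCast] at h1
  rw [zpow_neg, zpow_natCast] at h3
  rw [← h3, zpow_sub₀ (vv_ne_zero k), zpow_natCast, div_mul_eq_mul_div, div_mul_eq_mul_div, ← h2,
    h1]
  field_simp

theorem qInt_add (a b : ℤ) : qInt k (a + b) = vv k ^ b * qInt k a + vv k ^ (-a) * qInt k b := by
  have hv := vv_ne_zero k
  apply mul_left_cancel₀ (vv_sub_inv_ne_zero k)
  rw [mul_add, mul_left_comm, mul_left_comm _ (vv k ^ (-a)), sub_inv_mul_qInt, sub_inv_mul_qInt,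
    sub_inv_mul_qInt, mul_sub, mul_sub, ← zpow_add₀ hv, ← zpow_add₀ hv, ← zpow_add₀ hv,
    ← zpow_add₀ hv, neg_add, add_comm a b, add_comm (-a) b]
  ring

theorem vv_scalar_eq :
    (vv k)⁻¹ * (vv k ^ 2 - 1) ^ 2 = vv k * (vv k - (vv k)⁻¹) * (vv k - (vv k)⁻¹) := by
  have hv := vv_ne_zero k
  field_simp

/-- The last summand is the contribution of the `[𝕂]`-correction in the second recursion. It expands
to `(𝐯^a - 𝐯^(2-2b-a)) [b]`, so the middle summand cancels and `qInt_add` with `a` and `b` exchanged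
remains. -/
theorem qInt_add' (a b : ℤ) :
    qInt k (a + b) = vv k ^ (-b) * qInt k a + vv k ^ (2 - 2 * b - a) * qInt k b +
      (vv k * (vv k - (vv k)⁻¹) * qInt k (a + b - 1)) * (vv k ^ (-b) * qInt k b) := by
  have hv := vv_ne_zero k
  have h : vv k * (vv k - (vv k)⁻¹) * qInt k (a + b - 1) =
      vv k ^ (a + b) - vv k ^ (2 - a - b) := by
    rw [mul_assoc, sub_inv_mul_qInt, mul_sub, ← zpow_one_add₀ hv, ← zpow_one_add₀ hv]
    ring_nf
  have e1 : vv k ^ (a + b) * vv k ^ (-b) = vv k ^ a := by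
    rw [← zpow_add₀ hv]; congr 1; ring
  have e2 : vv k ^ (2 - a - b) * vv k ^ (-b) = vv k ^ (2 - 2 * b - a) := by
    rw [← zpow_add₀ hv]; congr 1; ring
  rw [h, ← mul_assoc, sub_mul, e1, e2, add_comm a b, qInt_add]
  ring

/-- Each term is a multiple of `idpCoeff k 1 (m + 1) (i + 1)`, and the multipliers satisfy
`qInt_add` with `a = m + 1` and `b = 2(i + 1)`. -/
theorem idpCoeff_one_succ_succ (m i : ℕ) :
    qInt k (m + 1 + 2 * (i + 1) : ℕ) * idpCoeff k 1 (m + 1) (i + 1) =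
      idpCoeff k (-1) m (i + 1) * (vv k ^ m)⁻¹ +
      idpCoeff k (-1) (m + 2) i * (vv k ^ (m + 2) - (vv k ^ (m + 2))⁻¹) := by
  have hv := vv_ne_zero k
  rw [idpCoeff_mul_sub k 1, idpCoeff_succ_left k 1 (-1) m (i + 1), Nat.cast_add, qInt_add,
    zpow_add₀ hv _ (m : ℤ), zpow_natCast _ m, Nat.cast_mul]
  have e : (i : ℤ) * (1 - -1) - 2 * i - 1 + 1 - (m + 1 : ℕ) = -(m + 1 : ℕ) := by ring
  have e' : ((i + 1 : ℕ) : ℤ) * (1 - -1) = (2 : ℕ) * (i + 1 : ℕ) := by push_cast; ring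
  rw [e, e']
  field_simp
  push_cast
  ring

/-- The boundary case of a pure power of `[𝕂]`: no simple summand is left, and the only source is
the nonsplit part of `[S] * [S]`. -/
theorem idpCoeff_one_zero_succ (i : ℕ) :
    qInt k (2 * (i + 1) : ℕ) * idpCoeff k 1 0 (i + 1) =
      idpCoeff k (-1) 1 i * (vv k ^ 1 - (vv k ^ 1)⁻¹) := by
  have e : (i : ℤ) * (1 - -1) - 2 * i - 1 + 1 - (0 : ℕ) = 0 := by push_cast; ring
  rw [idpCoeff_mul_sub k 1 (-1) 0, e, zpow_zero, one_mul]
  push_cast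
  rfl

/-- Expressed through `idpCoeff k (-1) (m + 1) (i + 1)`, this is `qInt_add'` with `a = m + 1` and `b
= 2(i + 1)`; the scalar of the correction term is rewritten as `𝐯(𝐯 - 𝐯⁻¹)²`. -/
theorem idpCoeff_neg_one_succ_succ (m i : ℕ) :
    qInt k (m + 1 + 2 * (i + 1) : ℕ) * idpCoeff k (-1) (m + 1) (i + 1) =
      idpCoeff k 1 m (i + 1) * (vv k ^ m)⁻¹ +
      idpCoeff k 1 (m + 2) i * (vv k ^ (m + 2) - (vv k ^ (m + 2))⁻¹) +
      (vv k)⁻¹ * (vv k ^ 2 - 1) ^ 2 * qInt k (m + 2 * (i + 1) : ℕ) *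
        idpCoeff k (-1) (m + 1) i := by
  have hv := vv_ne_zero k
  have e1 : (i : ℤ) * (-1 - 1) - 2 * i - 1 + -1 - (m + 1 : ℕ) =
      2 - 2 * (2 * (i + 1 : ℕ)) - (m + 1 : ℕ) := by push_cast; ring
  have e2 : ((i + 1 : ℕ) : ℤ) * (-1 - 1) = -(2 * (i + 1 : ℕ)) := by push_cast; ring
  have e3 : (i : ℤ) * (-1 - -1) - 2 * i - 1 + -1 = -(2 * (i + 1 : ℕ)) := by push_cast; ring
  have e4 : ((m + 2 * (i + 1) : ℕ) : ℤ) = (m + 1 : ℕ) + 2 * (i + 1 : ℕ) - 1 := by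
    push_cast; ring
  have e5 : ((m + 1 + 2 * (i + 1) : ℕ) : ℤ) = (m + 1 : ℕ) + 2 * (i + 1 : ℕ) := by
    push_cast; ring
  have h := idpCoeff_succ_right k (-1) (-1) (m + 1) i
  rw [e3] at h
  have h' : (vv k)⁻¹ * (vv k ^ 2 - 1) ^ 2 * qInt k (m + 2 * (i + 1) : ℕ) *
        idpCoeff k (-1) (m + 1) i = vv k * (vv k - (vv k)⁻¹) * qInt k (m + 2 * (i + 1) : ℕ) *
        ((vv k - (vv k)⁻¹) * idpCoeff k (-1) (m + 1) i) := by
    rw [vv_scalar_eq]; ring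
  rw [h', h, idpCoeff_mul_sub k (-1), idpCoeff_succ_left k (-1) 1 m (i + 1), e1, e2, e5, e4,
    qInt_add', zpow_add₀ hv _ (m : ℤ), zpow_natCast _ m]
  have hm : vv k ^ m * (vv k ^ m)⁻¹ = 1 := mul_inv_cancel₀ (pow_ne_zero _ hv)
  linear_combination (-(vv k ^ (-(2 * ((i + 1 : ℕ) : ℤ))) * qInt k (m + 1 : ℕ) *
    idpCoeff k (-1) (m + 1) (i + 1))) * hm

/-- The boundary case of a pure power of `[𝕂]`, which is `qInt_add'` with `a = 0`, where `[a]`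
vanishes. -/
theorem idpCoeff_neg_one_zero_succ (i : ℕ) :
    qInt k (2 * (i + 1) : ℕ) * idpCoeff k (-1) 0 (i + 1) =
      idpCoeff k 1 1 i * (vv k ^ 1 - (vv k ^ 1)⁻¹) +
      (vv k)⁻¹ * (vv k ^ 2 - 1) ^ 2 * qInt k (2 * i + 1 : ℕ) * idpCoeff k (-1) 0 i := by
  have e1 : (i : ℤ) * (-1 - 1) - 2 * i - 1 + -1 - (0 : ℕ) =
      2 - 2 * (2 * (i + 1 : ℕ)) - 0 := by push_cast; ring
  have e3 : (i : ℤ) * (-1 - -1) - 2 * i - 1 + -1 = -(2 * (i + 1 : ℕ)) := by push_cast; ring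
  have e4 : ((2 * i + 1 : ℕ) : ℤ) = 0 + 2 * (i + 1 : ℕ) - 1 := by
    push_cast; ring
  have e5 : ((2 * (i + 1) : ℕ) : ℤ) = 0 + 2 * (i + 1 : ℕ) := by
    push_cast; ring
  have h0 : qInt k 0 = 0 := by simp [qInt]
  have h := idpCoeff_succ_right k (-1) (-1) 0 i
  rw [e3] at h
  have h' : (vv k)⁻¹ * (vv k ^ 2 - 1) ^ 2 * qInt k (2 * i + 1 : ℕ) *
        idpCoeff k (-1) 0 i = vv k * (vv k - (vv k)⁻¹) * qInt k (2 * i + 1 : ℕ) *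
        ((vv k - (vv k)⁻¹) * idpCoeff k (-1) 0 i) := by
    rw [vv_scalar_eq]; ring
  rw [h', h, idpCoeff_mul_sub k (-1) 1 0, e1, e5, e4, qInt_add', h0]
  ring

end Coefficients

/-! ### Recursions for the expansions and comparison with the `ı`divided powers -/

section Expansions

variable (k : Type u) [Field k] [Finite k]

/-- The expansion of an `ı`divided power in the elements `[mS] * [𝕂]^i`. -/
noncomputable def idpExpansion (σ : ℤ) (n : ℕ) : IHallAlgebra k :=
  ∑ i ∈ Finset.range (n / 2 + 1), idpCoeff k σ (n - 2 * i) i • (clsNS k (n - 2 * i) * clsK k ^ i)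

/-- A sum over the decompositions `n = m + 2i`, with a large bound on `i`. -/
theorem sum_range_half {V : Type*} [AddCommMonoid V] (f : ℕ → V) {n N : ℕ} (h : n / 2 < N) :
    ∑ i ∈ Finset.range (n / 2 + 1), f i = ∑ i ∈ Finset.range N, if 2 * i ≤ n then f i else 0 := by
  rw [← Finset.sum_filter]
  congr 1
  ext i
  simp only [Finset.mem_range, Finset.mem_filter]
  omega

theorem clsK_mul_expansion_term (m i : ℕ) :
    clsK k * (clsNS k m * clsK k ^ i) = clsNS k m * clsK k ^ (i + 1) := by
  rw [← mul_assoc, clsK_mul_clsNS, mul_assoc, ← pow_succ']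

theorem clsS_mul_expansion_term (m i : ℕ) :
    clsS k * (clsNS k m * clsK k ^ i) = (vv k ^ m)⁻¹ • (clsNS k (m + 1) * clsK k ^ i) +
      (vv k ^ m - (vv k ^ m)⁻¹) • (clsNS k (m - 1) * clsK k ^ (i + 1)) := by
  rw [← mul_assoc, clsS_mul_clsNS, add_mul, smul_mul_assoc, smul_mul_assoc, mul_assoc _ (clsK k),
    ← pow_succ']

/-- The product is sorted by the exponent of `[𝕂]`. The exponent `i + 1` is reached from `i + 1` by
a split extension and from `i` by a nonsplit one. The sum is padded with zeros to a range free of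
floors, so that the recursions can be compared term by term with `smul_idpExpansion_succ`. -/
theorem clsS_mul_idpExpansion (σ : ℤ) (n : ℕ) :
    clsS k * idpExpansion k σ n =
      (idpCoeff k σ n 0 * (vv k ^ n)⁻¹) • (clsNS k (n + 1)) +
      ∑ i ∈ Finset.range (n + 1),
        ((if 2 * (i + 1) ≤ n then (idpCoeff k σ (n - 2 * (i + 1)) (i + 1) *
          (vv k ^ (n - 2 * (i + 1)))⁻¹) • (clsNS k (n + 1 - 2 * (i + 1)) * clsK k ^ (i + 1))
          else 0) +
        (if 2 * i ≤ n then (idpCoeff k σ (n - 2 * i) i *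
          (vv k ^ (n - 2 * i) - (vv k ^ (n - 2 * i))⁻¹)) •
            (clsNS k (n + 1 - 2 * (i + 1)) * clsK k ^ (i + 1)) else 0)) := by
  have h1 : clsS k * idpExpansion k σ n =
      (∑ i ∈ Finset.range (n / 2 + 1), (idpCoeff k σ (n - 2 * i) i *
          (vv k ^ (n - 2 * i))⁻¹) • (clsNS k (n - 2 * i + 1) * clsK k ^ i)) +
      ∑ i ∈ Finset.range (n / 2 + 1), (idpCoeff k σ (n - 2 * i) i *
          (vv k ^ (n - 2 * i) - (vv k ^ (n - 2 * i))⁻¹)) •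
            (clsNS k (n + 1 - 2 * (i + 1)) * clsK k ^ (i + 1)) := by
    rw [idpExpansion, Finset.mul_sum, ← Finset.sum_add_distrib]
    refine Finset.sum_congr rfl fun i _ => ?_
    rw [mul_smul_comm, clsS_mul_expansion_term, smul_add, smul_smul, smul_smul]
    have e : n - 2 * i - 1 = n + 1 - 2 * (i + 1) := by omega
    rw [e]
  -- The split part is padded by one index more than the nonsplit part, since its term `i = 0` is
  -- then peeled off and the remaining range must agree.
  rw [h1, sum_range_half _ (N := n + 2) (by omega), Finset.sum_range_succ',
    sum_range_half _ (N := n + 1) (by omega), Finset.sum_add_distrib, ← add_assoc]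
  congr 1
  rw [add_comm]
  congr 1
  · simp
  · refine Finset.sum_congr rfl fun i _ => ?_
    split_ifs with h
    · congr 3
      omega
    · rfl

theorem smul_idpExpansion_succ (c : QSqrt (Nat.card k)) (σ : ℤ) (n : ℕ) :
    c • idpExpansion k σ (n + 1) = (c * idpCoeff k σ (n + 1) 0) • clsNS k (n + 1) +
      ∑ i ∈ Finset.range (n + 1), if 2 * (i + 1) ≤ n + 1 then
        (c * idpCoeff k σ (n + 1 - 2 * (i + 1)) (i + 1)) •
          (clsNS k (n + 1 - 2 * (i + 1)) * clsK k ^ (i + 1)) else 0 := by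
  rw [idpExpansion, sum_range_half _ (N := n + 2) (by omega), Finset.sum_range_succ', smul_add,
    Finset.smul_sum, add_comm]
  congr 1
  · simp [smul_smul]
  · refine Finset.sum_congr rfl fun i _ => ?_
    rw [smul_ite, smul_smul, smul_zero]

/-- This mirrors the divided power whose parity is that of its index, which is `[S]` times the
preceding one up to a quantum integer. -/
theorem idpExpansion_one_succ (n : ℕ) :
    qInt k (n + 1 : ℕ) • idpExpansion k 1 (n + 1) = clsS k * idpExpansion k (-1) n := by
  rw [clsS_mul_idpExpansion, smul_idpExpansion_succ, idpCoeff_succ_zero k 1 (-1)]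
  congr 1
  refine Finset.sum_congr rfl fun i _ => ?_
  -- The cases are: a simple summand remains, only powers of `[𝕂]` remain, and the index lies
  -- outside the expansion.
  rcases lt_trichotomy (2 * (i + 1)) (n + 1) with h | h | h
  · obtain ⟨m, rfl⟩ : ∃ m, n = m + 2 * (i + 1) := ⟨n - 2 * (i + 1), by omega⟩
    rw [if_pos (by omega), if_pos (by omega), if_pos (by omega), ← add_smul]
    have e1 : m + 2 * (i + 1) + 1 - 2 * (i + 1) = m + 1 := by omega
    have e2 : m + 2 * (i + 1) - 2 * (i + 1) = m := by omega
    have e3 : m + 2 * (i + 1) - 2 * i = m + 2 := by omega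
    rw [e1, e2, e3, ← idpCoeff_one_succ_succ, add_right_comm]
  · obtain rfl : n = 2 * i + 1 := by omega
    rw [if_pos (by omega), if_neg (by omega), if_pos (by omega), zero_add]
    have e1 : 2 * i + 1 + 1 - 2 * (i + 1) = 0 := by omega
    have e3 : 2 * i + 1 - 2 * i = 1 := by omega
    rw [e1, e3, ← idpCoeff_one_zero_succ, h]
  · rw [if_neg (by omega), if_neg (by omega), zero_add]
    split_ifs with h'
    -- Outside the expansion the nonsplit term can survive only for `2i = n`, where its coefficient
    -- `𝐯⁰ - 𝐯⁰` is zero.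
    · have e : n - 2 * i = 0 := by omega
      rw [e]; simp
    · rfl

theorem idpExpansion_neg_one_succ (n : ℕ) :
    qInt k (n + 2 : ℕ) • idpExpansion k (-1) (n + 2) = clsS k * idpExpansion k 1 (n + 1) +
      ((vv k)⁻¹ * (vv k ^ 2 - 1) ^ 2 * qInt k (n + 1 : ℕ)) • (clsK k * idpExpansion k (-1) n) := by
  have hK : clsK k * idpExpansion k (-1) n = ∑ i ∈ Finset.range (n + 2),
      if 2 * i ≤ n then idpCoeff k (-1) (n - 2 * i) i •
        (clsNS k (n + 2 - 2 * (i + 1)) * clsK k ^ (i + 1)) else 0 := by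
    rw [← sum_range_half _ (by omega), idpExpansion, Finset.mul_sum]
    refine Finset.sum_congr rfl fun i _ => ?_
    rw [mul_smul_comm, clsK_mul_expansion_term]
    congr 3
    omega
  rw [clsS_mul_idpExpansion, smul_idpExpansion_succ, idpCoeff_succ_zero k (-1) 1, hK,
    Finset.smul_sum, add_assoc (_ • _), ← Finset.sum_add_distrib]
  congr 1
  refine Finset.sum_congr rfl fun i _ => ?_
  rw [smul_ite, smul_zero, smul_smul]
  rcases lt_trichotomy (2 * (i + 1)) (n + 2) with h | h | h
  · obtain ⟨m, rfl⟩ : ∃ m, n = m + 1 + 2 * i := ⟨n - (1 + 2 * i), by omega⟩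
    rw [if_pos (by omega), if_pos (by omega), if_pos (by omega), if_pos (by omega), ← add_smul,
      ← add_smul]
    have e1 : m + 1 + 2 * i + 1 + 1 - 2 * (i + 1) = m + 1 := by omega
    have e2 : m + 1 + 2 * i + 1 - 2 * (i + 1) = m := by omega
    have e3 : m + 1 + 2 * i + 1 - 2 * i = m + 2 := by omega
    have e4 : m + 1 + 2 * i - 2 * i = m + 1 := by omega
    have e5 : m + 1 + 2 * i + 2 = m + 1 + 2 * (i + 1) := by omega
    have e6 : m + 1 + 2 * i + 1 = m + 2 * (i + 1) := by omega
    rw [e1, e2, e3, e4, e5, e6, ← idpCoeff_neg_one_succ_succ]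
  · obtain rfl : n = 2 * i := by omega
    rw [if_pos (by omega), if_neg (by omega), if_pos (by omega), if_pos (by omega), zero_add,
      ← add_smul]
    have e1 : 2 * i + 1 + 1 - 2 * (i + 1) = 0 := by omega
    have e3 : 2 * i + 1 - 2 * i = 1 := by omega
    have e4 : 2 * i - 2 * i = 0 := by omega
    rw [e1, e3, e4, ← idpCoeff_neg_one_zero_succ, h]
  · rw [if_neg (by omega), if_neg (by omega), if_neg (by omega : ¬ 2 * i ≤ n), zero_add, add_zero]
    split_ifs with h'
    -- Only `2i = n + 1` is possible here, and the coefficient is again `𝐯⁰ - 𝐯⁰`.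
    · have e : n + 1 - 2 * i = 0 := by omega
      rw [e]; simp
    · rfl

theorem idpCoeff_zero_zero (σ : ℤ) : idpCoeff k σ 0 0 = 1 := by
  simp [idpCoeff, qFact, qDoubleFact]

theorem idpExpansion_zero (σ : ℤ) : idpExpansion k σ 0 = 1 := by
  simp [idpExpansion, idpCoeff_zero_zero, clsNS_zero]

theorem idpExpansion_one (σ : ℤ) : idpExpansion k σ 1 = clsS k := by
  have h := idpCoeff_succ_zero k σ 0 0
  have h1 : qInt k 1 = 1 := by simp [qInt, vv_sub_inv_ne_zero]
  simp only [idpCoeff_zero_zero, zero_add, Nat.cast_one, h1, one_mul, pow_zero, inv_one] at h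
  simp [idpExpansion, h, clsNS_one]

theorem commute_clsS_idpFactor (r : ℤ) : Commute (clsS k) (idpFactor k r) :=
  ((Commute.refl _).pow_right 2).add_right
    (Commute.smul_right (clsK_mul_clsS k).symm _)

theorem commute_clsK_idpFactor (r : ℤ) : Commute (clsK k) (idpFactor k r) :=
  (Commute.pow_right (clsK_mul_clsS k) 2).add_right ((Commute.refl _).smul_right _)

/-- Products of the factors of the `ı`divided powers. -/
noncomputable def idpProd (r : ℕ → ℤ) (n : ℕ) : IHallAlgebra k :=
  ((List.range n).map fun j => idpFactor k (r j)).prod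

/-- In `idpOdd` and `idpEven` the index of the product is an integer, so the list of natural numbers
is coerced through the list monad. This lemma replaces it by a list indexed by natural numbers. -/
theorem idpProd_eq (r : ℤ → ℤ) (n : ℕ) :
    (List.map (fun j : ℤ => idpFactor k (r j)) (List.range n >>= fun a => pure (a : ℤ))).prod =
      idpProd k (fun j => r j) n := by
  rw [idpProd, List.bind_eq_flatMap, List.map_flatMap]
  congr 1
  exact List.flatMap_pure_eq_map _ _

theorem commute_clsS_idpProd (r : ℕ → ℤ) (n : ℕ) : Commute (clsS k) (idpProd k r n) :=
  Commute.list_prod_right _ _ fun x hx => by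
    obtain ⟨j, -, rfl⟩ := List.mem_map.1 hx
    exact commute_clsS_idpFactor k _

theorem commute_clsK_idpProd (r : ℕ → ℤ) (n : ℕ) : Commute (clsK k) (idpProd k r n) :=
  Commute.list_prod_right _ _ fun x hx => by
    obtain ⟨j, -, rfl⟩ := List.mem_map.1 hx
    exact commute_clsK_idpFactor k _

theorem idpProd_succ (r : ℕ → ℤ) (n : ℕ) :
    idpProd k r (n + 1) = clsS k ^ 2 * idpProd k r n +
      ((vv k)⁻¹ * (vv k ^ 2 - 1) ^ 2 * qInt k (r n) ^ 2) • (clsK k * idpProd k r n) := by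
  have h1 := (commute_clsS_idpProd k r n).pow_left 2
  have h2 := commute_clsK_idpProd k r n
  rw [h1.eq, h2.eq, ← mul_smul_comm, ← mul_add]
  simp [idpProd, List.range_succ, idpFactor]

/-- The first factor contains `[0] = 0` and is therefore `[S]²`; the others are shifted by one
index. -/
theorem idpProd_even_succ (n : ℕ) :
    idpProd k (fun j => 2 * (j + 1) - 2) (n + 1) =
      clsS k ^ 2 * idpProd k (fun j => 2 * (j + 1)) n := by
  have h : idpFactor k 0 = clsS k ^ 2 := by simp [idpFactor, qInt]
  rw [idpProd, List.range_succ_eq_map, List.map_cons, List.prod_cons, List.map_map, idpProd]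
  simp only [Nat.cast_zero, zero_add, mul_one, sub_self, h]
  congr 3
  funext j
  simp only [Function.comp_apply, Nat.cast_succ]
  congr 1
  ring

theorem qFact_smul_idpExpansion_one (n : ℕ) :
    qFact k (n + 1) • idpExpansion k 1 (n + 1) = clsS k * (qFact k n • idpExpansion k (-1) n) := by
  rw [qFact_succ, mul_smul, idpExpansion_one_succ, mul_smul_comm]

/-- Eliminating `E_1(n+1)` from the two recursions leaves multiplication by the single factor with
`[n+1]²`. The second power of `[n+1]` comes from clearing the factorial. -/
theorem qFact_smul_idpExpansion_neg_one (n : ℕ) :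
    qFact k (n + 2) • idpExpansion k (-1) (n + 2) =
      clsS k ^ 2 * (qFact k n • idpExpansion k (-1) n) +
      ((vv k)⁻¹ * (vv k ^ 2 - 1) ^ 2 * qInt k (n + 1 : ℕ) ^ 2) •
        (clsK k * (qFact k n • idpExpansion k (-1) n)) := by
  rw [qFact_succ, mul_smul, idpExpansion_neg_one_succ, smul_add, ← mul_smul_comm,
    qFact_smul_idpExpansion_one, ← mul_assoc, ← sq, mul_smul_comm _ (clsK k), smul_smul, smul_smul,
    qFact_succ]
  congr 2
  ring

theorem qFact_smul_idpExpansion_even (m : ℕ) :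
    qFact k (2 * m) • idpExpansion k (-1) (2 * m) = idpProd k (fun j => 2 * (j + 1) - 1) m := by
  induction m with
  | zero => simp [qFact, idpExpansion_zero, idpProd]
  | succ m ih =>
    have e : ((2 * m + 1 : ℕ) : ℤ) = 2 * ((m : ℤ) + 1) - 1 := by push_cast; ring
    rw [mul_add, mul_one, qFact_smul_idpExpansion_neg_one, ih, idpProd_succ, e]

theorem qFact_smul_idpExpansion_odd (m : ℕ) :
    qFact k (2 * m + 1) • idpExpansion k (-1) (2 * m + 1) =
      clsS k * idpProd k (fun j => 2 * (j + 1)) m := by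
  induction m with
  | zero =>
    have h1 : qInt k 1 = 1 := by simp [qInt, vv_sub_inv_ne_zero]
    simp [qFact, idpExpansion_one, idpProd, h1]
  | succ m ih =>
    have e : ((2 * m + 1 + 1 : ℕ) : ℤ) = 2 * ((m : ℤ) + 1) := by push_cast; ring
    have e' : 2 * (m + 1) + 1 = 2 * m + 1 + 2 := by ring
    have hK (x : IHallAlgebra k) : clsK k * (clsS k * x) = clsS k * (clsK k * x) := by
      rw [← mul_assoc, clsK_mul_clsS, mul_assoc]
    rw [e', qFact_smul_idpExpansion_neg_one, ih, idpProd_succ, e, mul_add (clsS k), mul_smul_comm, hK,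
      ← mul_assoc (clsS k ^ 2), ← mul_assoc (clsS k) (clsS k ^ 2), ← pow_succ, ← pow_succ']

/-- For even `n > 0` the vanishing `[0]` in the first factor makes the product `[S]` times the
odd-index one, which is the recursion for `σ = 1`. For odd `n` it is the two-step recursion for `σ =
-1`. -/
theorem idpEven_eq (n : ℕ) : idpEven k n = idpExpansion k ((-1) ^ n) n := by
  rw [idpEven, inv_smul_eq_iff₀ (qFact_ne_zero k n)]
  rcases Nat.even_or_odd' n with ⟨m, rfl | rfl⟩
  · rw [if_neg (by simp), Even.neg_one_pow (even_two_mul m),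
      Nat.mul_div_cancel_left m two_pos]
    cases m with
    | zero => simp [qFact, idpExpansion_zero]
    | succ m =>
      rw [mul_add, mul_one, qFact_smul_idpExpansion_one, qFact_smul_idpExpansion_odd, ← mul_assoc,
        ← sq, ← idpProd_even_succ]
      exact idpProd_eq k (fun j => 2 * (j + 1) - 2) (m + 1)
  · rw [if_pos (odd_two_mul_add_one m), Odd.neg_one_pow (odd_two_mul_add_one m),
      qFact_smul_idpExpansion_odd]
    have e : (2 * m + 1) / 2 = m := by omega
    rw [e]
    exact congrArg _ (idpProd_eq k (fun j => 2 * (j + 1)) m)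

/-- The roles of the parities are exchanged: even `n` uses the two-step recursion for `σ = -1`, and
odd `n` adds one factor `[S]`. -/
theorem idpOdd_eq (n : ℕ) : idpOdd k n = idpExpansion k (-(-1) ^ n) n := by
  rw [idpOdd, inv_smul_eq_iff₀ (qFact_ne_zero k n)]
  rcases Nat.even_or_odd' n with ⟨m, rfl | rfl⟩
  · rw [if_neg (by simp), Even.neg_one_pow (even_two_mul m),
      Nat.mul_div_cancel_left m two_pos, qFact_smul_idpExpansion_even]
    exact idpProd_eq k (fun j => 2 * (j + 1) - 1) m
  · rw [if_pos (odd_two_mul_add_one m), Odd.neg_one_pow (odd_two_mul_add_one m), neg_neg,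
      qFact_smul_idpExpansion_one, qFact_smul_idpExpansion_even]
    have e : (2 * m + 1) / 2 = m := by omega
    rw [e]
    exact congrArg _ (idpProd_eq k (fun j => 2 * (j + 1) - 1) m)

end Expansions

end IHall

theorem mainTheorem10 {k : Type*} [Field k] [Finite k] (n : ℕ) :
    IHall.idpEven k n =
      ∑ i ∈ Finset.range (n / 2 + 1),
        (IHall.vv k ^ ((i : ℤ) * ((i : ℤ) - (-1) ^ n) - ((n - 2 * i).choose 2 : ℕ)) *
          (IHall.vv k - (IHall.vv k)⁻¹) ^ i /
            (IHall.qFact k (n - 2 * i) * IHall.qDoubleFact k i)) •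
          (IHall.clsNS k (n - 2 * i) * IHall.clsK k ^ i) ∧
    IHall.idpOdd k n =
      ∑ i ∈ Finset.range (n / 2 + 1),
        (IHall.vv k ^ ((i : ℤ) * ((i : ℤ) + (-1) ^ n) - ((n - 2 * i).choose 2 : ℕ)) *
          (IHall.vv k - (IHall.vv k)⁻¹) ^ i /
            (IHall.qFact k (n - 2 * i) * IHall.qDoubleFact k i)) •
          (IHall.clsNS k (n - 2 * i) * IHall.clsK k ^ i) := by 
  refine ⟨IHall.idpEven_eq k n, (IHall.idpOdd_eq k n).trans ?_⟩
  simp only [IHall.idpExpansion, IHall.idpCoeff, sub_neg_eq_add]
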